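/- **Setting.** Let $q_1,\dots,q_r$ be distinct primes. For a prime $\ell$, give $\mathbb{Q}_\ell$ the Haar measure with $\operatorname{vol}(\mathbb{Z}_\ell)=1$. For $z\in\mathbb{Q}_\ell^\times$ with $v=v_\ell(z)$ and $z_0=z\ell^{-v}$, define the modified norm by $|z|'_\ell=\ell^{-2\lfloor v/2\rfloor}$ if $\ell\ne2$, and for $\ell=2$ by $|z|'_2=2^{-v}$ if $v$ is even and $z_0\equiv1\ (4)$, $|z|_2'=2^{-v+2}$ if $v$ is even and $z_0\equiv3\ (4)$, and $|z|'_2=2^{-v+3}$ if $v$ is odd. Put $\mathrm{e}(x)=e^{2\pi i x}$ for $x\in\mathbb{R}$ and $\mathrm{e}_\ell(z)=\mathrm{e}(-\langle z\rangle_\ell)$ for $z\in\mathbb{Q}_\ell$, where $\langle\cdot\rangle_\ell$ is the $\ell$-adic fractional part. Let $\Phi:(0,\infty)\to\mathbb{C}$ be smooth, with all derivatives of rapid decay at $+\infty$. Suppose that its Mellin transform $\widetilde\Phi(s)$ converges absolutely in some right half-plane and continues to a holomorphic function on $\operatorname{Re}s>0$ that is of rapid decay in $\operatorname{Im}s$,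 uniformly for $\operatorname{Re}s$ in compact subsets of $(0,\infty)$. Fix a sign $\pm$, $\nu\in\mathbb{Z}^r$, $\iota\in\{0,1\}$, $\epsilon\in\{0,\pm1\}^r$, and $a_0,\dots,a_r\in\mathbb{C}$ with $\operatorname{Re}a_i>-2$. For an integer $n>0$ prime to all $q_i$ let $N=\pm n\prod_i q_i^{\nu_i}$. Let $X_0=\{x\in\mathbb{R}: x^2\mp1>0\}$, $X_1=\{x\in\mathbb{R}:x^2\mp1<0\}$, $$Y_{\epsilon_i}=\Big\{y\in\mathbb{Q}_{q_i}: y^2\neq4N,\ \Big(\tfrac{(y^2-4N)|y^2-4N|'_{q_i}}{q_i}\Big)=\epsilon_i\Big\}$$ (Kronecker symbol), and $Y_\epsilon=\prod_iY_{\epsilon_i}$. Let $\overline\varphi$ be a function on $X_\iota$ that is smooth up to the boundary and vanishes outside a bounded set, and let $\overline\psi_i$ be locally constant, compactly supported functions on $\mathbb{Q}_{q_i}$ (only their restrictions to $Y_{\epsilon_i}$ matter). Put $\varphi(x)=|x^2\mp1|^{a_0/2}\overline\varphi(x)$ and $\psi_i(y_i)=|y_i^2-4N|_{q_i}'^{\,a_i/2}\,\overline\psi_i(y_i)$.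 For $C>0$, $\xi\in\mathbb{R}$ and $\eta\in\prod_i\mathbb{Q}_{q_i}$ let $$F_{\iota,\epsilon}(\xi,\eta)=\int_{X_\iota}\int_{Y_\epsilon}\varphi(x)\prod_{i=1}^r\psi_i(y_i)\;\Phi\!\left(\frac{C}{|x^2\mp1|^{1/2}\prod_i|y_i^2-4N|_{q_i}'^{\,1/2}}\right)\mathrm{e}(-x\xi)\prod_{i=1}^r\mathrm{e}_{q_i}(-y_i\eta_i)\,dx\,dy,$$ and let $[\![\xi,\eta]\!]=(1+|\xi|)\prod_{i=1}^r(1+|\eta_i|_{q_i})$. **Theorem.** The integral converges absolutely, and for every real $M>0$ there is a constant $K$, depending only on $M$, $\Phi$, the $q_i$, the sign, $\nu$, $\iota$, $\epsilon$, the $a_i$, $\overline\varphi$ and the $\overline\psi_i$ (and not on $n$, $C$, $\xi$, $\eta$), such that $$|F_{\iota,\epsilon}(\xi,\eta)|\le K\,\big(C^2[\![\xi,\eta]\!]\big)^{-M}(1+|\xi|)^{-1-\operatorname{Re}(a_0)/2}\prod_{i=1}^r(1+|\eta_i|_{q_i})^{-1-\operatorname{Re}(a_i)/2}$$ for all integers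 $n>0$ prime to all $q_i$, all $C>0$, all $\xi\in\mathbb{R}$ and all $\eta\in\prod_i\mathbb{Q}_{q_i}$. -/

import Mathlib

open MeasureTheory Filter Asymptotics
open scoped ContDiff

namespace Semilocal

/-! ### The field of `p`-adic numbers as a measure space -/

noncomputable instance padicMeasurableSpace (p : ℕ) [Fact p.Prime] : MeasurableSpace ℚ_[p] := borel ℚ_[p]

instance padicBorelSpace (p : ℕ) [Fact p.Prime] : BorelSpace ℚ_[p] := ⟨rfl⟩

/-- The closed unit ball `ℤ_p` of `ℚ_p`, as a compact set with nonempty interior. -/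
def unitBall (p : ℕ) [Fact p.Prime] : TopologicalSpace.PositiveCompacts ℚ_[p] where
  carrier := Metric.closedBall 0 1
  isCompact' := isCompact_closedBall 0 1
  interior_nonempty' :=
    ⟨0, Metric.ball_subset_interior_closedBall (Metric.mem_ball_self one_pos)⟩

/-- The Haar measure on `ℚ_p` for which `ℤ_p` has volume `1`. -/
noncomputable def padicHaar (p : ℕ) [Fact p.Prime] : Measure ℚ_[p] :=
  Measure.addHaarMeasure (unitBall p)

instance padicHaar_isAddHaar (p : ℕ) [Fact p.Prime] : (padicHaar p).IsAddHaarMeasure :=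
  Measure.isAddHaarMeasure_addHaarMeasure _

/-! ### Modified norm, quadratic symbol and additive character on `ℚ_p` -/

open Classical in
/-- The integer `e` with `|z|'_p = p ^ e`, for `z ≠ 0`. -/
noncomputable def modExp (p : ℕ) [Fact p.Prime] (z : ℚ_[p]) : ℤ :=
  if p = 2 then
    if Even z.valuation then
      -- the unit part of `z` is congruent to `1`, respectively to `3`, modulo `4`
      if ‖z * (p : ℚ_[p]) ^ (-z.valuation) - 1‖ ≤ 1 / 4 then -z.valuation
      else -z.valuation + 2
    else -z.valuation + 3
  else -(2 * (z.valuation / 2))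

open Classical in
/-- The modified norm `|z|'_p`. -/
noncomputable def modNorm (p : ℕ) [Fact p.Prime] (z : ℚ_[p]) : ℝ :=
  if z = 0 then 0 else (p : ℝ) ^ modExp p z

theorem norm_mul_modExp_le (p : ℕ) [Fact p.Prime] (z : ℚ_[p]) :
    ‖z * (p : ℚ_[p]) ^ modExp p z‖ ≤ 1 := by
  have hp : (1 : ℝ) < p := by exact_mod_cast (Fact.out : p.Prime).one_lt
  by_cases hz : z = 0
  · simp [hz]
  rw [norm_mul, Padic.norm_eq_zpow_neg_valuation hz, Padic.norm_p_zpow, ← zpow_add₀ (by positivity)]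
  apply zpow_le_one_of_nonpos₀ hp.le
  unfold modExp
  split_ifs <;> omega

/-- The Kronecker symbol `(w / p)` of a `p`-adic integer `w` at the prime `p`: the Legendre symbol
of `w` modulo `p` if `p` is odd; for `p = 2` it is `0` if `w` is even, `1` if `w ≡ ±1 mod 8` and
`-1` if `w ≡ ±3 mod 8`. -/
noncomputable def kroneckerAt (p : ℕ) [Fact p.Prime] (w : ℤ_[p]) : ℤ :=
  if p = 2 then ZMod.χ₈ ((w.appr 3 : ℕ) : ZMod 8) else legendreSym p (w.appr 1 : ℤ)

/-- The symbol `(z |z|'_p / p)` for `z` in `ℚ_p`. -/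
noncomputable def padicSymbol (p : ℕ) [Fact p.Prime] (z : ℚ_[p]) : ℤ :=
  kroneckerAt p ⟨z * (p : ℚ_[p]) ^ modExp p z, norm_mul_modExp_le p z⟩

theorem norm_mul_pow_le (p : ℕ) [Fact p.Prime] (z : ℚ_[p]) :
    ‖z * (p : ℚ_[p]) ^ (-z.valuation).toNat‖ ≤ 1 := by
  have hp : (1 : ℝ) < p := by exact_mod_cast (Fact.out : p.Prime).one_lt
  by_cases hz : z = 0
  · simp [hz]
  rw [norm_mul, Padic.norm_eq_zpow_neg_valuation hz, Padic.norm_p_pow, ← zpow_add₀ (by positivity)]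
  apply zpow_le_one_of_nonpos₀ hp.le
  omega

/-- The fractional part of `z = ∑ a_j p ^ j` in `ℚ_p`, i.e. the sum over `j < 0`. With
`k = max (-v_p z) 0` it is `m / p ^ k`, where `0 ≤ m < p ^ k` and `m ≡ p ^ k z mod p ^ k`. -/
noncomputable def padicFract (p : ℕ) [Fact p.Prime] (z : ℚ_[p]) : ℚ :=
  (PadicInt.appr ⟨z * (p : ℚ_[p]) ^ (-z.valuation).toNat, norm_mul_pow_le p z⟩
    (-z.valuation).toNat : ℚ) / (p : ℚ) ^ (-z.valuation).toNat

/-- `e(x) = exp (2 π i x)`. -/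
noncomputable def e (x : ℝ) : ℂ := Complex.exp (2 * Real.pi * Complex.I * x)

/-- `e_p(z) = e(-⟨z⟩_p)`; note the minus sign. -/
noncomputable def padicE (p : ℕ) [Fact p.Prime] (z : ℚ_[p]) : ℂ := e (-(padicFract p z : ℝ))

/-! ### The domains `X_ι` and `Y_ε`

The sign `±` is an element `sgn` of `ℤˣ`. -/

/-- `X_0 = {x | x ^ 2 ∓ 1 > 0}` and `X_1 = {x | x ^ 2 ∓ 1 < 0}`. -/
def X (sgn : ℤˣ) (ι : Fin 2) : Set ℝ :=
  if ι = 0 then {x | 0 < x ^ 2 - ((sgn : ℤ) : ℝ)} else {x | x ^ 2 - ((sgn : ℤ) : ℝ) < 0}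

/-- `N = ± n q ^ ν`. -/
noncomputable def bigN {r : ℕ} (q : Fin r → ℕ) (sgn : ℤˣ) (ν : Fin r → ℤ) (n : ℕ) : ℚ :=
  ((sgn : ℤ) : ℚ) * (n : ℚ) * ∏ i, (q i : ℚ) ^ ν i

/-- `Y_ε = {y | y ^ 2 ≠ 4 N and ω_p(y) = ε}`, where
`ω_p(y) = ((y ^ 2 - 4 N) |y ^ 2 - 4 N|'_p / p)`. -/
def Y (p : ℕ) [Fact p.Prime] (N : ℚ) (ε : ℤ) : Set ℚ_[p] :=
  {y | y ^ 2 - 4 * (N : ℚ_[p]) ≠ 0 ∧ padicSymbol p (y ^ 2 - 4 * (N : ℚ_[p])) = ε}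

/-! ### The class of test functions and the condition on their Mellin transforms -/

/-- Smooth functions on `(0, ∞)` all of whose derivatives decay rapidly at `+∞`. -/
def ClassS (Φ : ℝ → ℂ) : Prop :=
  ContDiffOn ℝ ∞ Φ (Set.Ioi 0) ∧
    ∀ k m : ℕ, (fun x => iteratedDeriv k Φ x) =O[atTop] fun x : ℝ => x ^ (-(m : ℝ))

/-- The Mellin transform of `Φ` converges absolutely on some right half-plane and continues to a
holomorphic function on `Re s > 0`, which decays rapidly in `Im s`, uniformly for `Re s` in compact
subsets of `(0, ∞)`. -/
def MellinRapid (Φ : ℝ → ℂ) : Prop :=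
  ∃ G : ℂ → ℂ, DifferentiableOn ℂ G {s | 0 < s.re} ∧
    (∃ σ₀ : ℝ, 0 ≤ σ₀ ∧ ∀ s : ℂ, σ₀ < s.re → HasMellin Φ s (G s)) ∧
    ∀ σ₁ σ₂ : ℝ, 0 < σ₁ → ∀ k : ℕ, ∃ B : ℝ, ∀ s : ℂ, σ₁ ≤ s.re → s.re ≤ σ₂ →
      |s.im| ^ k * ‖G s‖ ≤ B

/-- `f` is smooth on `X` and up to the boundary, and vanishes outside a bounded subset of `X`.
(Only the values of `f` on `X` matter in what follows; those on the boundary are the limits.) -/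
def SmoothUpToBoundary (X : Set ℝ) (f : ℝ → ℂ) : Prop :=
  ContDiffOn ℝ ∞ f (closure X) ∧ ∃ R : ℝ, ∀ x ∈ X, R < |x| → f x = 0

/-! ### The integral -/

/-- `|x ^ 2 ∓ 1|`. -/
noncomputable def archNorm (sgn : ℤˣ) (x : ℝ) : ℝ := |x ^ 2 - ((sgn : ℤ) : ℝ)|

/-- `φ(x) = |x ^ 2 ∓ 1| ^ (a₀ / 2) φ̄(x)`. -/
noncomputable def phi (sgn : ℤˣ) (a₀ : ℂ) (φbar : ℝ → ℂ) (x : ℝ) : ℂ :=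
  (archNorm sgn x : ℂ) ^ (a₀ / 2) * φbar x

/-- `ψ(y) = |y ^ 2 - 4 N|'_p ^ (a / 2) ψ̄(y)`. -/
noncomputable def psi (p : ℕ) [Fact p.Prime] (N : ℚ) (a : ℂ) (ψbar : ℚ_[p] → ℂ) (y : ℚ_[p]) : ℂ :=
  (modNorm p (y ^ 2 - 4 * (N : ℚ_[p])) : ℂ) ^ (a / 2) * ψbar y

variable {r : ℕ} (q : Fin r → ℕ) [∀ i, Fact (q i).Prime]

/-- The measure `dx dy` on `ℝ × ∏ ℚ_{q_i}`. -/
noncomputable def semilocalMeasure : Measure (ℝ × (∀ i, ℚ_[q i])) :=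
  (volume : Measure ℝ).prod (Measure.pi fun i => padicHaar (q i))

/-- The domain of integration `X_ι × ∏ Y_{ε_i}`. -/
def domain (sgn : ℤˣ) (N : ℚ) (ι : Fin 2) (ε : Fin r → ℤ) : Set (ℝ × (∀ i, ℚ_[q i])) :=
  X sgn ι ×ˢ Set.pi Set.univ fun i => Y (q i) N (ε i)

/-- The function of `(x, y)` under the integral sign in the definition of `F_{ι, ε}(ξ, η)`. -/
noncomputable def integrand (sgn : ℤˣ) (N : ℚ) (Φ : ℝ → ℂ) (a₀ : ℂ) (a : Fin r → ℂ) (φbar : ℝ → ℂ)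
    (ψbar : ∀ i, ℚ_[q i] → ℂ) (C ξ : ℝ) (η : ∀ i, ℚ_[q i]) (z : ℝ × (∀ i, ℚ_[q i])) : ℂ :=
  phi sgn a₀ φbar z.1 * (∏ i, psi (q i) N (a i) (ψbar i) (z.2 i)) *
    Φ (C / (archNorm sgn z.1 ^ (1 / 2 : ℝ) *
      (∏ i, modNorm (q i) (z.2 i ^ 2 - 4 * (N : ℚ_[q i]))) ^ (1 / 2 : ℝ))) *
    e (-(z.1 * ξ)) * ∏ i, padicE (q i) (-(z.2 i * η i))

/-- `⟦ξ, η⟧ = (1 + |ξ|) ∏ (1 + |η_i|)`. -/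
noncomputable def bracket (ξ : ℝ) (η : ∀ i, ℚ_[q i]) : ℝ := (1 + |ξ|) * ∏ i, (1 + ‖η i‖)

end Semilocal

/-! Mellin inversion decouples the places. On the line `Re s = 2M`, `Φ t` is an integral of `g y * t
^ (-s)` over `s = 2M + iy`. At the argument of `Φ`, the power `t ^ (-s)` is `C ^ (-s)` times the
powers with exponent `s / 2` of `|x² ∓ 1|` and of each modified norm (`cpow_neg_div_sqrt`). By
Fubini (`mellin_kernel_integral`) the integral becomes one over `y` of `g y * C ^ (-s)` times a
product of local Fourier integrals whose singular exponent `b` has real part `c = Re a_i / 2 + M >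
-1`. Each of these is `O((1 + |frequency|) ^ (-1 - c))`, and `|C ^ (-s)| = C ^ (-2M)`; together
these are the asserted powers. The constant at the real place grows polynomially in `|b|`, which the
decay of `g` absorbs.

At a finite place (`padic_local_bound`), for large `η`, translate by `h` with `‖h‖ = p / ‖η‖`. Away
from the set where `‖y² - 4N‖` is smaller than a constant times `‖h‖`, everything but the character
is invariant under `h`, so that part of the integral vanishes. The excluded set contributes `O(‖h‖ ^
(c + 1))`, because the sublevel sets of `‖y² - 4N‖` have measure linear in the level. Only the norm
of `4N` enters, and it does not depend on `n`; this gives the uniformity.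

At the real place (`IsEdgeWeight.integral_bound`), cut at distance `1 / |ξ|` from the end points.
The end pieces are bounded trivially. In the middle, repeated integration by parts gains `1 / |ξ|`
each time and loses at most one power of the distance to the end points. -/

namespace Semilocal

/-! ### The additive character of `ℚ_p` -/

theorem e_add (x y : ℝ) : e (x + y) = e x * e y := by
  simp only [e, ← Complex.exp_add]
  congr 1
  push_cast
  ring

theorem norm_e (x : ℝ) : ‖e x‖ = 1 := by
  have : e x = Complex.exp ((2 * Real.pi * x : ℝ) * Complex.I) := by
    simp only [e]
    congr 1
    push_cast
    ring
  rw [this, Complex.norm_exp_ofReal_mul_I]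

theorem e_intCast (n : ℤ) : e n = 1 := by
  have : e n = Complex.exp (n * (2 * Real.pi * Complex.I)) := by
    simp only [e]
    congr 1
    push_cast
    ring
  rw [this, Complex.exp_int_mul_two_pi_mul_I]

section Character

variable (p : ℕ) [Fact p.Prime]

theorem norm_padicE (z : ℚ_[p]) : ‖padicE p z‖ = 1 := norm_e _

theorem norm_sub_padicFract_le (z : ℚ_[p]) : ‖z - (padicFract p z : ℚ_[p])‖ ≤ 1 := by
  have hp : (1 : ℝ) < p := by exact_mod_cast (Fact.out : p.Prime).one_lt
  have hp0 : (p : ℚ_[p]) ≠ 0 := by exact_mod_cast (Fact.out : p.Prime).ne_zero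
  set k := (-z.valuation).toNat with hk
  set w : ℤ_[p] := ⟨z * (p : ℚ_[p]) ^ k, norm_mul_pow_le p z⟩ with hw
  have h1 : ‖w - (w.appr k : ℤ_[p])‖ ≤ (p : ℝ) ^ (-k : ℤ) :=
    (PadicInt.norm_le_pow_iff_mem_span_pow _ _).2 (PadicInt.appr_spec k w)
  have h2 : z - (padicFract p z : ℚ_[p]) =
      ((w - (w.appr k : ℤ_[p]) : ℤ_[p]) : ℚ_[p]) * ((p : ℚ_[p]) ^ k)⁻¹ := by
    have hf : padicFract p z = (w.appr k : ℚ) / (p : ℚ) ^ k := rfl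
    rw [hf]
    push_cast
    rw [hw]
    field_simp
  rw [h2, norm_mul, norm_inv, Padic.norm_p_pow, PadicInt.padic_norm_e_of_padicInt,
    ← zpow_neg, neg_neg]
  calc _ ≤ (p : ℝ) ^ (-k : ℤ) * (p : ℝ) ^ (k : ℤ) := by gcongr
    _ = 1 := by rw [← zpow_add₀ (by positivity)]; simp

theorem exists_padicFract_mul_pow (z : ℚ_[p]) :
    ∃ (k : ℕ) (m : ℤ), padicFract p z * (p : ℚ) ^ k = m := by
  have hp0 : (p : ℚ) ≠ 0 := by exact_mod_cast (Fact.out : p.Prime).ne_zero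
  refine ⟨(-z.valuation).toNat, ((PadicInt.appr ⟨z * (p : ℚ_[p]) ^ (-z.valuation).toNat,
    norm_mul_pow_le p z⟩ (-z.valuation).toNat : ℕ) : ℤ), ?_⟩
  rw [padicFract, div_mul_cancel₀ _ (pow_ne_zero _ hp0)]
  simp

theorem exists_int_of_mul_pow_of_norm_le_one {x : ℚ} {k : ℕ} {m : ℤ} (h : x * (p : ℚ) ^ k = m)
    (hx : ‖(x : ℚ_[p])‖ ≤ 1) : ∃ n : ℤ, x = n := by
  have hp : (1 : ℝ) < p := by exact_mod_cast (Fact.out : p.Prime).one_lt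
  have hp0 : (p : ℚ) ≠ 0 := by exact_mod_cast (Fact.out : p.Prime).ne_zero
  have h1 : ((m : ℤ) : ℚ_[p]) = (x : ℚ_[p]) * (p : ℚ_[p]) ^ k := by
    have : ((m : ℚ) : ℚ_[p]) = ((x * (p : ℚ) ^ k : ℚ) : ℚ_[p]) := by rw [h]
    push_cast at this
    exact this
  have h2 : ‖((m : ℤ) : ℚ_[p])‖ ≤ (p : ℝ) ^ (-k : ℤ) := by
    rw [h1, norm_mul, Padic.norm_p_pow]
    exact mul_le_of_le_one_left (by positivity) hx
  obtain ⟨n, hn⟩ := (Padic.norm_int_le_pow_iff_dvd m k).1 h2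
  refine ⟨n, ?_⟩
  have : x * (p : ℚ) ^ k = n * (p : ℚ) ^ k := by
    rw [h, hn]; push_cast; ring
  exact mul_right_cancel₀ (pow_ne_zero _ hp0) this

/-- The fractional part is additive only up to an integer: the defect has a power of `p` as
denominator and is `p`-adically integral, so it lies in `ℤ` and is invisible to `e`. -/
theorem padicE_add (x y : ℚ_[p]) : padicE p (x + y) = padicE p x * padicE p y := by
  obtain ⟨k₁, m₁, h₁⟩ := exists_padicFract_mul_pow p (x + y)
  obtain ⟨k₂, m₂, h₂⟩ := exists_padicFract_mul_pow p x
  obtain ⟨k₃, m₃, h₃⟩ := exists_padicFract_mul_pow p y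
  set d : ℚ := padicFract p (x + y) - padicFract p x - padicFract p y with hd
  have hd1 : d * (p : ℚ) ^ (k₁ + k₂ + k₃) =
      ((m₁ * p ^ (k₂ + k₃) - m₂ * p ^ (k₁ + k₃) - m₃ * p ^ (k₁ + k₂) : ℤ) : ℚ) := by
    push_cast
    rw [← h₁, ← h₂, ← h₃, hd]
    ring
  have hd2 : ‖(d : ℚ_[p])‖ ≤ 1 := by
    have : (d : ℚ_[p]) = (-(x + y - (padicFract p (x + y) : ℚ_[p])) +
        (x - (padicFract p x : ℚ_[p]))) + (y - (padicFract p y : ℚ_[p])) := by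
      rw [hd]; push_cast; ring
    rw [this]
    refine (Padic.nonarchimedean _ _).trans (max_le ((Padic.nonarchimedean _ _).trans
      (max_le ?_ ?_)) ?_)
    · rw [norm_neg]; exact norm_sub_padicFract_le p _
    · exact norm_sub_padicFract_le p _
    · exact norm_sub_padicFract_le p _
  obtain ⟨n, hn⟩ := exists_int_of_mul_pow_of_norm_le_one p hd1 hd2
  have h4 : (padicFract p (x + y) : ℝ) = (padicFract p x : ℝ) + (padicFract p y : ℝ) + n := by
    have : padicFract p (x + y) = padicFract p x + padicFract p y + n := by
      rw [← hn, hd]; ring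
    rw [this]; push_cast; ring
  rw [padicE, padicE, padicE, ← e_add, h4]
  have : (-((padicFract p x : ℝ) + (padicFract p y : ℝ) + n)) =
      (-(padicFract p x : ℝ) + -(padicFract p y : ℝ)) + ((-n : ℤ) : ℝ) := by push_cast; ring
  rw [this, e_add, e_intCast, mul_one]

theorem padicE_eq_one {z : ℚ_[p]} (hz : ‖z‖ ≤ 1) : padicE p z = 1 := by
  obtain ⟨k, m, h⟩ := exists_padicFract_mul_pow p z
  have : ‖(padicFract p z : ℚ_[p])‖ ≤ 1 := by
    have h1 : (padicFract p z : ℚ_[p]) = z + -(z - (padicFract p z : ℚ_[p])) := by ring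
    rw [h1]
    refine (Padic.nonarchimedean _ _).trans (max_le hz ?_)
    rw [norm_neg]; exact norm_sub_padicFract_le p z
  obtain ⟨n, hn⟩ := exists_int_of_mul_pow_of_norm_le_one p h this
  rw [padicE, hn]
  simpa using e_intCast (-n)

theorem continuous_padicE : Continuous (padicE p) := by
  refine continuous_iff_continuousAt.2 fun z => ?_
  refine (continuousAt_const (y := padicE p z)).congr ?_
  filter_upwards [Metric.closedBall_mem_nhds z one_pos] with w hw
  rw [Metric.mem_closedBall, dist_eq_norm] at hw
  have := padicE_add p (w - z) z
  rw [sub_add_cancel, padicE_eq_one p hw, one_mul] at this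
  exact this.symm

theorem e_ne_one {x : ℝ} (h0 : 0 < x) (h1 : x < 1) : e (-x) ≠ 1 := by
  intro h
  rw [e, Complex.exp_eq_one_iff] at h
  obtain ⟨n, hn⟩ := h
  have h2 : ((-x : ℝ) : ℂ) = ((n : ℝ) : ℂ) := by
    have hne : (2 * Real.pi * Complex.I : ℂ) ≠ 0 := Complex.two_pi_I_ne_zero
    apply mul_left_cancel₀ hne
    rw [hn]; push_cast; ring
  have h3 : -x = n := by exact_mod_cast h2
  have h4 : (n : ℝ) < 0 := by linarith
  have h5 : (-1 : ℝ) < n := by linarith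
  have h6 : n < 0 := by exact_mod_cast h4
  have h7 : -1 < n := by exact_mod_cast h5
  omega

/-- The witness is `p⁻¹`: its fractional part lies in `[0, 1)` and is nonzero because `p⁻¹` is not
integral. The exact norm later fixes the length of the translation attached to `η`. -/
theorem exists_padicE_ne_one : ∃ z : ℚ_[p], ‖z‖ = p ∧ padicE p z ≠ 1 := by
  by_contra! hcon
  have hp : (1 : ℝ) < p := by exact_mod_cast (Fact.out : p.Prime).one_lt
  have hp0 : (p : ℚ_[p]) ≠ 0 := by exact_mod_cast (Fact.out : p.Prime).ne_zero
  have hz : ‖(p : ℚ_[p])⁻¹‖ = p := by rw [norm_inv, Padic.norm_p, inv_inv]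
  have h := hcon _ hz
  set f := padicFract p (p : ℚ_[p])⁻¹ with hf
  have hk : (-((p : ℚ_[p])⁻¹).valuation).toNat = 1 := by
    rw [Padic.valuation_inv, Padic.valuation_p]; rfl
  have hlt : 0 ≤ f ∧ f < 1 := by
    rw [hf, padicFract]
    refine ⟨by positivity, ?_⟩
    have hpos : (0 : ℚ) < p := by exact_mod_cast (Fact.out : p.Prime).pos
    rw [div_lt_one (by positivity)]
    exact_mod_cast PadicInt.appr_lt _ _
  have hne : f ≠ 0 := by
    intro h0
    have := norm_sub_padicFract_le p (p : ℚ_[p])⁻¹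
    rw [← hf, h0, Rat.cast_zero, sub_zero, hz] at this
    linarith
  refine e_ne_one (x := (f : ℝ)) ?_ ?_ h
  · exact_mod_cast lt_of_le_of_ne hlt.1 (Ne.symm hne)
  · exact_mod_cast hlt.2

end Character

/-! ### Haar measure of balls -/

section Balls

variable (p : ℕ) [Fact p.Prime]

theorem padicHaar_closedBall_zero_one : padicHaar p (Metric.closedBall 0 1) = 1 :=
  Measure.addHaarMeasure_self

/-- The balls of this radius around `0, …, p ^ k - 1` are disjoint, have equal volume and lie in the
unit ball. -/
theorem padicHaar_closedBall_zpow_le (a : ℚ_[p]) (k : ℕ) :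
    padicHaar p (Metric.closedBall a ((p : ℝ) ^ (-k : ℤ))) ≤
      ENNReal.ofReal ((p : ℝ) ^ (-k : ℤ)) := by
  have hp : (1 : ℝ) < p := by exact_mod_cast (Fact.out : p.Prime).one_lt
  set ρ : ℝ := (p : ℝ) ^ (-k : ℤ) with hρ
  have hρ1 : ρ ≤ 1 := zpow_le_one_of_nonpos₀ hp.le (by omega)
  have htrans : ∀ b : ℚ_[p], padicHaar p (Metric.closedBall b ρ) =
      padicHaar p (Metric.closedBall a ρ) := by
    intro b
    have := measure_preimage_add (padicHaar p) (b - a) (Metric.closedBall b ρ)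
    rw [← this]
    congr 1
    ext x
    simp only [Set.mem_preimage, Metric.mem_closedBall, dist_eq_norm]
    rw [show b - a + x - b = x - a by ring]
  have hsum : ∑ j ∈ Finset.range (p ^ k),
      padicHaar p (Metric.closedBall ((j : ℕ) : ℚ_[p]) ρ) ≤ 1 := by
    rw [← padicHaar_closedBall_zero_one p, ← measure_biUnion_finset]
    · refine measure_mono (Set.iUnion₂_subset fun j _ x hx => ?_)
      rw [Metric.mem_closedBall, dist_eq_norm] at hx ⊢
      rw [sub_zero, show x = (x - j) + j by ring]
      refine (Padic.nonarchimedean _ _).trans (max_le (hx.trans hρ1) ?_)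
      exact_mod_cast Padic.norm_int_le_one (p := p) j
    · intro i hi j hj hij
      simp only [Finset.coe_range, Set.mem_Iio] at hi hj
      refine Set.disjoint_left.2 fun x hx hx' => hij ?_
      rw [Metric.mem_closedBall, dist_eq_norm] at hx hx'
      have h1 : ‖(((i : ℤ) - (j : ℤ) : ℤ) : ℚ_[p])‖ ≤ (p : ℝ) ^ (-k : ℤ) := by
        have : (((i : ℤ) - (j : ℤ) : ℤ) : ℚ_[p]) = (x - j) + -(x - i) := by push_cast; ring
        rw [this]
        refine (Padic.nonarchimedean _ _).trans (max_le hx' ?_)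
        rw [norm_neg]; exact hx
      have h2 := (Padic.norm_int_le_pow_iff_dvd _ _).1 h1
      have h3 : (j : ℤ) ≡ i [ZMOD ((p ^ k : ℕ) : ℤ)] :=
        (Int.modEq_iff_dvd).2 (by exact_mod_cast h2)
      have h4 := (Int.natCast_modEq_iff).1 h3
      exact (Nat.ModEq.eq_of_lt_of_lt h4 hj hi).symm
    · intro j _
      exact Metric.isClosed_closedBall.measurableSet
  simp only [htrans, Finset.sum_const, Finset.card_range, nsmul_eq_mul] at hsum
  have hpk : ((p ^ k : ℕ) : ENNReal) ≠ 0 := by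
    exact_mod_cast pow_ne_zero _ (Fact.out : p.Prime).ne_zero
  have h5 : padicHaar p (Metric.closedBall a ρ) ≤ (((p ^ k : ℕ) : ENNReal))⁻¹ := by
    rw [ENNReal.le_inv_iff_mul_le, mul_comm]
    exact hsum
  refine h5.trans (le_of_eq ?_)
  rw [hρ, zpow_neg, ENNReal.ofReal_inv_of_pos (by positivity)]
  congr 1
  rw [zpow_natCast, ← Nat.cast_pow, ENNReal.ofReal_natCast]

/-- Rounding `ρ` up to a power of `p` costs at most the factor `p`. -/
theorem padicHaar_closedBall_le (a : ℚ_[p]) {ρ : ℝ} (h0 : 0 < ρ) (h1 : ρ ≤ 1) :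
    padicHaar p (Metric.closedBall a ρ) ≤ ENNReal.ofReal (p * ρ) := by
  have hp : (1 : ℝ) < p := by exact_mod_cast (Fact.out : p.Prime).one_lt
  obtain ⟨k, hk1, hk2⟩ := exists_nat_pow_near_of_lt_one h0 h1
    (inv_pos.2 (zero_lt_one.trans hp)) (inv_lt_one_of_one_lt₀ hp)
  have hk : ∀ m : ℕ, ((p : ℝ)⁻¹) ^ m = (p : ℝ) ^ (-m : ℤ) := by
    intro m; rw [zpow_neg, inv_pow, zpow_natCast]
  refine (measure_mono (Metric.closedBall_subset_closedBall hk2)).trans ?_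
  rw [hk]
  refine (padicHaar_closedBall_zpow_le p a k).trans (ENNReal.ofReal_le_ofReal ?_)
  rw [← hk]
  rw [pow_succ] at hk1
  have : (p : ℝ)⁻¹ ^ k = p * ((p : ℝ)⁻¹ ^ k * (p : ℝ)⁻¹) := by
    field_simp
  rw [this]
  gcongr

end Balls

/-! ### Integrals of powers from bounds for sublevel sets -/

/-- Dyadic decomposition by the size of `f`: the layer at height `t = δ / 2 ^ k` contributes `O(t ^
(c + 1))`, a geometric series since `c > -1`. The constant is chosen before the measure and the
function, which is what makes later bounds uniform in `N`. -/
theorem lintegral_rpow_sublevel_le {A c : ℝ} (hc : -1 < c) :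
    ∃ K : ℝ, 0 ≤ K ∧ ∀ {α : Type*} [MeasurableSpace α] (μ : Measure α) (f : α → ℝ)
      (S : Set α), (∀ δ : ℝ, 0 < δ → μ (S ∩ {x | f x ≤ δ}) ≤ ENNReal.ofReal (A * δ)) →
      ∀ δ : ℝ, 0 < δ → ∫⁻ x in S ∩ {x | 0 < f x ∧ f x ≤ δ}, ENNReal.ofReal (f x ^ c) ∂μ ≤
        ENNReal.ofReal (K * δ ^ (c + 1)) := by
  -- Bounds the variation of `f ^ c` across one dyadic layer for either sign of `c`.
  set m : ℝ := max 1 ((1 / 2 : ℝ) ^ c) with hm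
  set ρ : ℝ := (1 / 2 : ℝ) ^ (c + 1) with hρ
  have hρ0 : 0 ≤ ρ := by positivity
  have hρ1 : ρ < 1 := Real.rpow_lt_one (by norm_num) (by norm_num) (by linarith)
  have hm0 : 0 ≤ m := le_trans zero_le_one (le_max_left _ _)
  refine ⟨m * |A| * (1 - ρ)⁻¹, mul_nonneg (mul_nonneg hm0 (abs_nonneg _))
    (inv_nonneg.2 (by linarith)), ?_⟩
  intro α _ μ f S hS δ hδ
  set E : ℕ → Set α := fun k => S ∩ {x | δ * (1 / 2) ^ (k + 1) < f x ∧ f x ≤ δ * (1 / 2) ^ k}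
  have hcover : S ∩ {x | 0 < f x ∧ f x ≤ δ} ⊆ ⋃ k, E k := by
    rintro x ⟨hxS, hx0, hx1⟩
    obtain ⟨k, hk1, hk2⟩ := exists_nat_pow_near_of_lt_one (x := f x / δ) (y := (1 / 2 : ℝ))
      (by positivity) ((div_le_one hδ).2 hx1) (by norm_num) (by norm_num)
    refine Set.mem_iUnion.2 ⟨k, hxS, ?_, ?_⟩
    · rw [lt_div_iff₀ hδ] at hk1; linarith
    · rw [div_le_iff₀ hδ] at hk2; linarith
  have hbound : ∀ k : ℕ, ∫⁻ x in E k, ENNReal.ofReal (f x ^ c) ∂μ ≤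
      ENNReal.ofReal (m * |A| * δ ^ (c + 1) * ρ ^ k) := by
    intro k
    set t : ℝ := δ * (1 / 2) ^ k with ht
    have ht0 : 0 < t := by positivity
    have hpt : ∀ x ∈ E k, ENNReal.ofReal (f x ^ c) ≤ ENNReal.ofReal (m * t ^ c) := by
      rintro x ⟨-, hx1, hx2⟩
      refine ENNReal.ofReal_le_ofReal ?_
      have hx1' : t * (1 / 2) < f x := by rw [ht]; rw [pow_succ] at hx1; linarith
      have hx0 : 0 < f x := lt_trans (by positivity) hx1'
      rcases le_total 0 c with h | h
      · calc f x ^ c ≤ t ^ c := Real.rpow_le_rpow hx0.le hx2 h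
          _ ≤ m * t ^ c := le_mul_of_one_le_left (by positivity) (le_max_left _ _)
      · calc f x ^ c ≤ (t * (1 / 2)) ^ c :=
            Real.rpow_le_rpow_of_nonpos (by positivity) hx1'.le h
          _ = (1 / 2 : ℝ) ^ c * t ^ c := by
            rw [Real.mul_rpow ht0.le (by norm_num), mul_comm]
          _ ≤ m * t ^ c := by gcongr; exact le_max_right _ _
    calc ∫⁻ x in E k, ENNReal.ofReal (f x ^ c) ∂μ
        ≤ ∫⁻ x in E k, ENNReal.ofReal (m * t ^ c) ∂μ :=
          setLIntegral_mono measurable_const hpt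
      _ = ENNReal.ofReal (m * t ^ c) * μ (E k) := by rw [setLIntegral_const]
      _ ≤ ENNReal.ofReal (m * t ^ c) * ENNReal.ofReal (|A| * t) := by
          gcongr
          refine (measure_mono ?_).trans ((hS t ht0).trans (ENNReal.ofReal_le_ofReal ?_))
          · exact Set.inter_subset_inter_right _ fun x hx => hx.2
          · gcongr; exact le_abs_self A
      _ = ENNReal.ofReal (m * |A| * δ ^ (c + 1) * ρ ^ k) := by
          rw [← ENNReal.ofReal_mul (by positivity)]
          congr 1
          have h1 : t ^ c * t = t ^ (c + 1) := by rw [Real.rpow_add_one ht0.ne']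
          have h2 : t ^ (c + 1) = δ ^ (c + 1) * ρ ^ k := by
            rw [ht, Real.mul_rpow hδ.le (by positivity), hρ, ← Real.rpow_natCast,
              ← Real.rpow_natCast, ← Real.rpow_mul (by norm_num), ← Real.rpow_mul (by norm_num),
              mul_comm (c + 1)]
          calc m * t ^ c * (|A| * t) = m * |A| * (t ^ c * t) := by ring
            _ = _ := by rw [h1, h2]; ring
  calc ∫⁻ x in S ∩ {x | 0 < f x ∧ f x ≤ δ}, ENNReal.ofReal (f x ^ c) ∂μ
      ≤ ∫⁻ x in ⋃ k, E k, ENNReal.ofReal (f x ^ c) ∂μ := lintegral_mono_set hcover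
    _ ≤ ∑' k, ∫⁻ x in E k, ENNReal.ofReal (f x ^ c) ∂μ := lintegral_iUnion_le _ _
    _ ≤ ∑' k, ENNReal.ofReal (m * |A| * δ ^ (c + 1) * ρ ^ k) := ENNReal.tsum_le_tsum hbound
    _ = ENNReal.ofReal (∑' k, m * |A| * δ ^ (c + 1) * ρ ^ k) := by
        rw [ENNReal.ofReal_tsum_of_nonneg]
        · intro k; positivity
        · exact (summable_geometric_of_lt_one hρ0 hρ1).mul_left _
    _ = ENNReal.ofReal (m * |A| * (1 - ρ)⁻¹ * δ ^ (c + 1)) := by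
        rw [tsum_mul_left, tsum_geometric_of_lt_one hρ0 hρ1]
        congr 1
        ring

/-! ### Local constancy of the modified norm and of the symbol -/

section ModNorm

variable (p : ℕ) [Fact p.Prime]

/-- The relative precision `‖8p‖` serves all primes. For odd `p` it is `1 / p`, enough for the
Legendre symbol; for `p = 2` it is `1 / 16`, finer than the congruences modulo `4` and `8` behind
`modExp` and the Kronecker symbol. Being less than `1`, it preserves valuations. -/
theorem norm_eight_mul_pos : 0 < ‖(8 * p : ℚ_[p])‖ := by
  have : (p : ℚ_[p]) ≠ 0 := by exact_mod_cast (Fact.out : p.Prime).ne_zero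
  rw [norm_pos_iff]
  exact mul_ne_zero (by norm_num) this

theorem norm_eight_mul_lt_one : ‖(8 * p : ℚ_[p])‖ < 1 := by
  rw [norm_mul]
  have h1 : ‖(8 : ℚ_[p])‖ ≤ 1 := by exact_mod_cast Padic.norm_int_le_one (p := p) 8
  have h2 : ‖(p : ℚ_[p])‖ < 1 := Padic.norm_p_lt_one
  nlinarith [norm_nonneg (8 : ℚ_[p]), norm_nonneg (p : ℚ_[p])]

variable {p}

theorem norm_eq_of_norm_sub_lt {z w : ℚ_[p]} (h : ‖w - z‖ < ‖z‖) : ‖w‖ = ‖z‖ := by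
  have h1 := Padic.add_eq_max_of_ne (p := p) h.ne
  rw [sub_add_cancel] at h1
  rw [h1, max_eq_right h.le]

theorem norm_sub_lt_of_le {z w : ℚ_[p]} (hz : z ≠ 0) (h : ‖w - z‖ ≤ ‖(8 * p : ℚ_[p])‖ * ‖z‖) :
    ‖w - z‖ < ‖z‖ := by
  have := norm_eight_mul_lt_one p
  have := norm_pos_iff.2 hz
  nlinarith

theorem valuation_eq_of_norm_eq {z w : ℚ_[p]} (hz : z ≠ 0) (hw : w ≠ 0) (h : ‖w‖ = ‖z‖) :
    w.valuation = z.valuation := by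
  have hp : (1 : ℝ) < p := by exact_mod_cast (Fact.out : p.Prime).one_lt
  rw [Padic.norm_eq_zpow_neg_valuation hz, Padic.norm_eq_zpow_neg_valuation hw] at h
  have := zpow_right_injective₀ (zero_lt_one.trans hp) hp.ne' h
  simpa using this

theorem modExp_eq_of_norm_sub_le {z w : ℚ_[p]} (hz : z ≠ 0)
    (h : ‖w - z‖ ≤ ‖(8 * p : ℚ_[p])‖ * ‖z‖) : modExp p w = modExp p z := by
  have hlt := norm_sub_lt_of_le hz h
  have hn := norm_eq_of_norm_sub_lt hlt
  have hw : w ≠ 0 := by rw [← norm_pos_iff, hn]; exact norm_pos_iff.2 hz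
  have hv := valuation_eq_of_norm_eq hz hw hn
  by_cases hp2 : p = 2
  · have hdiff : ‖w * (p : ℚ_[p]) ^ (-z.valuation) - 1 - (z * (p : ℚ_[p]) ^ (-z.valuation) - 1)‖
        ≤ 1 / 4 := by
      have hp0 : (0 : ℝ) < p := by exact_mod_cast (Fact.out : p.Prime).pos
      have : w * (p : ℚ_[p]) ^ (-z.valuation) - 1 - (z * (p : ℚ_[p]) ^ (-z.valuation) - 1) =
          (w - z) * (p : ℚ_[p]) ^ (-z.valuation) := by ring
      rw [this, norm_mul, Padic.norm_p_zpow]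
      have h8 : ‖(8 * p : ℚ_[p])‖ ≤ 1 / 4 := by
        subst hp2
        have : (8 * (2 : ℕ) : ℚ_[2]) = ((2 : ℕ) : ℚ_[2]) ^ 4 := by norm_num
        rw [this, Padic.norm_p_pow]
        norm_num
      have hz1 : ‖z‖ * (p : ℝ) ^ (- -z.valuation) = 1 := by
        rw [Padic.norm_eq_zpow_neg_valuation hz, ← zpow_add₀ hp0.ne']; simp
      calc _ ≤ ‖(8 * p : ℚ_[p])‖ * ‖z‖ * (p : ℝ) ^ (- -z.valuation) := by gcongr
        _ = ‖(8 * p : ℚ_[p])‖ := by rw [mul_assoc, hz1, mul_one]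
        _ ≤ 1 / 4 := h8
    have hiff : ‖w * (p : ℚ_[p]) ^ (-z.valuation) - 1‖ ≤ 1 / 4 ↔
        ‖z * (p : ℚ_[p]) ^ (-z.valuation) - 1‖ ≤ 1 / 4 := by
      set a := w * (p : ℚ_[p]) ^ (-z.valuation) - 1
      set b := z * (p : ℚ_[p]) ^ (-z.valuation) - 1
      constructor
      · intro ha
        have : b = a + -(a - b) := by ring
        rw [this]
        exact (Padic.nonarchimedean _ _).trans (max_le ha (by rwa [norm_neg]))
      · intro hb
        have : a = b + (a - b) := by ring
        rw [this]
        exact (Padic.nonarchimedean _ _).trans (max_le hb hdiff)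
    unfold modExp
    rw [hv]
    simp only [hiff]
  · unfold modExp
    rw [hv]
    simp [hp2]

theorem appr_eq_of_norm_sub_le {x y : ℤ_[p]} {n : ℕ} (h : ‖x - y‖ ≤ (p : ℝ) ^ (-n : ℤ)) :
    x.appr n = y.appr n := by
  have h0 := (PadicInt.norm_le_pow_iff_mem_span_pow _ _).1 h
  rw [← PadicInt.ker_toZModPow, RingHom.mem_ker, map_sub, sub_eq_zero] at h0
  have h1 : ((x.appr n : ℕ) : ZMod (p ^ n)) = (y.appr n : ℕ) := h0
  rw [ZMod.natCast_eq_natCast_iff] at h1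
  exact Nat.ModEq.eq_of_lt_of_lt h1 (PadicInt.appr_lt _ _) (PadicInt.appr_lt _ _)

/-- Scaling by `p ^ modExp p z` makes the argument integral, so relative closeness becomes absolute
closeness within `‖8p‖`. -/
theorem padicSymbol_eq_of_norm_sub_le {z w : ℚ_[p]} (hz : z ≠ 0)
    (h : ‖w - z‖ ≤ ‖(8 * p : ℚ_[p])‖ * ‖z‖) : padicSymbol p w = padicSymbol p z := by
  have he := modExp_eq_of_norm_sub_le hz h
  unfold padicSymbol
  have hw := norm_mul_modExp_le p w
  have hz' := norm_mul_modExp_le p z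
  have hp0 : (0 : ℝ) < p := by exact_mod_cast (Fact.out : p.Prime).pos
  set x : ℤ_[p] := ⟨w * (p : ℚ_[p]) ^ modExp p w, hw⟩ with hx
  set y : ℤ_[p] := ⟨z * (p : ℚ_[p]) ^ modExp p z, hz'⟩ with hy
  have hxy : ‖x - y‖ ≤ ‖(8 * p : ℚ_[p])‖ := by
    have : ‖x - y‖ = ‖(w - z) * (p : ℚ_[p]) ^ modExp p z‖ := by
      rw [← PadicInt.padic_norm_e_of_padicInt, PadicInt.coe_sub, hx, hy]
      simp only [he]
      congr 1
      ring
    rw [this, norm_mul]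
    rw [norm_mul] at hz'
    calc _ ≤ ‖(8 * p : ℚ_[p])‖ * ‖z‖ * ‖(p : ℚ_[p]) ^ modExp p z‖ := by gcongr
      _ = ‖(8 * p : ℚ_[p])‖ * (‖z‖ * ‖(p : ℚ_[p]) ^ modExp p z‖) := by ring
      _ ≤ _ := mul_le_of_le_one_right (norm_nonneg _) hz'
  unfold kroneckerAt
  by_cases hp2 : p = 2
  · rw [if_pos hp2, if_pos hp2, appr_eq_of_norm_sub_le (x := x) (y := y)]
    refine hxy.trans ?_
    subst hp2
    have : (8 * (2 : ℕ) : ℚ_[2]) = ((2 : ℕ) : ℚ_[2]) ^ 4 := by norm_num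
    rw [this, Padic.norm_p_pow]
    norm_num
  · rw [if_neg hp2, if_neg hp2, appr_eq_of_norm_sub_le (x := x) (y := y)]
    refine hxy.trans ?_
    rw [norm_mul]
    have h1 : ‖(8 : ℚ_[p])‖ ≤ 1 := by exact_mod_cast Padic.norm_int_le_one (p := p) 8
    refine (mul_le_of_le_one_left (norm_nonneg _) h1).trans (le_of_eq ?_)
    rw [Padic.norm_p]; simp

theorem modNorm_eq_of_norm_sub_le {z w : ℚ_[p]} (hz : z ≠ 0)
    (h : ‖w - z‖ ≤ ‖(8 * p : ℚ_[p])‖ * ‖z‖) : modNorm p w = modNorm p z := by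
  have hn := norm_eq_of_norm_sub_lt (norm_sub_lt_of_le hz h)
  have hw : w ≠ 0 := by rw [← norm_pos_iff, hn]; exact norm_pos_iff.2 hz
  rw [modNorm, modNorm, if_neg hz, if_neg hw, modExp_eq_of_norm_sub_le hz h]

theorem modNorm_pos {z : ℚ_[p]} (hz : z ≠ 0) : 0 < modNorm p z := by
  have hp0 : (0 : ℝ) < p := by exact_mod_cast (Fact.out : p.Prime).pos
  rw [modNorm, if_neg hz]
  positivity

theorem norm_le_modNorm {z : ℚ_[p]} (hz : z ≠ 0) : ‖z‖ ≤ modNorm p z := by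
  have hp : (1 : ℝ) ≤ p := by exact_mod_cast (Fact.out : p.Prime).one_lt.le
  rw [modNorm, if_neg hz, Padic.norm_eq_zpow_neg_valuation hz]
  refine zpow_le_zpow_right₀ hp ?_
  unfold modExp
  split_ifs <;> omega

/-- The exponent `3` is the worst case, occurring for `p = 2` at odd valuation. -/
theorem modNorm_le {z : ℚ_[p]} (hz : z ≠ 0) : modNorm p z ≤ (p : ℝ) ^ 3 * ‖z‖ := by
  have hp : (1 : ℝ) ≤ p := by exact_mod_cast (Fact.out : p.Prime).one_lt.le
  rw [modNorm, if_neg hz, Padic.norm_eq_zpow_neg_valuation hz, ← zpow_natCast,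
    ← zpow_add₀ (by positivity)]
  refine zpow_le_zpow_right₀ hp ?_
  unfold modExp
  split_ifs <;> push_cast <;> omega

theorem modNorm_rpow_le {z : ℚ_[p]} (hz : z ≠ 0) (c : ℝ) :
    modNorm p z ^ c ≤ max 1 (((p : ℝ) ^ 3) ^ c) * ‖z‖ ^ c := by
  have hz0 := norm_pos_iff.2 hz
  rcases le_total 0 c with h | h
  · calc modNorm p z ^ c ≤ ((p : ℝ) ^ 3 * ‖z‖) ^ c :=
        Real.rpow_le_rpow (modNorm_pos hz).le (modNorm_le hz) h
      _ = ((p : ℝ) ^ 3) ^ c * ‖z‖ ^ c := Real.mul_rpow (by positivity) hz0.le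
      _ ≤ _ := by gcongr; exact le_max_right _ _
  · calc modNorm p z ^ c ≤ ‖z‖ ^ c :=
        Real.rpow_le_rpow_of_nonpos hz0 (norm_le_modNorm hz) h
      _ ≤ _ := le_mul_of_one_le_left (by positivity) (le_max_left _ _)

end ModNorm

/-! ### The local integrals at the finite places -/

section PadicLocal

variable {p : ℕ} [Fact p.Prime]

theorem norm_sub_le_max (x y : ℚ_[p]) : ‖x - y‖ ≤ max ‖x‖ ‖y‖ := by
  rw [sub_eq_add_neg, ← norm_neg y]
  exact Padic.nonarchimedean _ _

/-- For small `δ` the condition forces `‖y‖ = √κ`, hence `‖2y‖ = L`. If `y₀` is another solution,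
the factors of `(y - y₀) * (y + y₀)` have product of norm at most `δ` and sum `2y`; so one has norm
at least `L` and the other at most `δ / L`, which leaves two balls. For `δ` bounded below, the
volume of the whole ball suffices. -/
theorem padicHaar_sublevel_le {κ B : ℝ} (hκ : 0 < κ) :
    ∃ A : ℝ, ∀ a : ℚ_[p], ‖a‖ = κ → ∀ δ : ℝ, 0 < δ →
      padicHaar p (Metric.closedBall 0 B ∩ {y | ‖y ^ 2 - a‖ ≤ δ}) ≤ ENNReal.ofReal (A * δ) := by
  set L : ℝ := ‖(2 : ℚ_[p])‖ * √κ with hL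
  have hL0 : 0 < L := mul_pos (norm_pos_iff.2 (by norm_num)) (Real.sqrt_pos.2 hκ)
  set V : ℝ := (padicHaar p (Metric.closedBall 0 B)).toReal with hV
  have hVtop : padicHaar p (Metric.closedBall (0 : ℚ_[p]) B) ≠ ⊤ :=
    (isCompact_closedBall _ _).measure_lt_top.ne
  set m := min κ L with hm
  have hm0 : 0 < m := lt_min hκ hL0
  have hp0 : (0 : ℝ) < p := by exact_mod_cast (Fact.out : p.Prime).pos
  refine ⟨2 * (p / L) + V / m, fun a ha δ hδ => ?_⟩
  rcases lt_or_ge δ m with hlt | hge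
  · have hδκ : δ < κ := hlt.trans_le (min_le_left _ _)
    have hδL : δ < L := hlt.trans_le (min_le_right _ _)
    rcases Set.eq_empty_or_nonempty (Metric.closedBall (0 : ℚ_[p]) B ∩ {y | ‖y ^ 2 - a‖ ≤ δ})
      with hemp | ⟨y₀, -, hy₀⟩
    · rw [hemp, measure_empty]; exact zero_le
    · have hsub : Metric.closedBall (0 : ℚ_[p]) B ∩ {y | ‖y ^ 2 - a‖ ≤ δ} ⊆
          Metric.closedBall y₀ (δ / L) ∪ Metric.closedBall (-y₀) (δ / L) := by
        rintro y ⟨-, hy⟩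
        simp only [Set.mem_ofPred_eq] at hy hy₀
        have hyn : ‖y‖ = √κ := by
          have h1 : ‖y ^ 2‖ = ‖a‖ := norm_eq_of_norm_sub_lt (by rw [ha]; exact hy.trans_lt hδκ)
          rw [norm_pow, ha] at h1
          rw [← h1, Real.sqrt_sq (norm_nonneg _)]
        have hmul : ‖y - y₀‖ * ‖y + y₀‖ ≤ δ := by
          rw [← norm_mul, show (y - y₀) * (y + y₀) = (y ^ 2 - a) - (y₀ ^ 2 - a) by ring]
          exact (norm_sub_le_max _ _).trans (max_le hy hy₀)
        have h2y : L ≤ max ‖y - y₀‖ ‖y + y₀‖ := by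
          rw [hL, ← hyn, ← norm_mul, show 2 * y = (y - y₀) + (y + y₀) by ring]
          exact Padic.nonarchimedean _ _
        rcases le_max_iff.1 h2y with h | h
        · right
          rw [Metric.mem_closedBall, dist_eq_norm, sub_neg_eq_add, le_div_iff₀ hL0]
          nlinarith [norm_nonneg (y + y₀)]
        · left
          rw [Metric.mem_closedBall, dist_eq_norm, le_div_iff₀ hL0]
          nlinarith [norm_nonneg (y - y₀)]
      have hq0 : 0 < δ / L := by positivity
      have hq1 : δ / L ≤ 1 := (div_le_one hL0).2 hδL.le
      calc _ ≤ _ := measure_mono hsub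
        _ ≤ _ := measure_union_le _ _
        _ ≤ ENNReal.ofReal (p * (δ / L)) + ENNReal.ofReal (p * (δ / L)) :=
          add_le_add (padicHaar_closedBall_le p _ hq0 hq1) (padicHaar_closedBall_le p _ hq0 hq1)
        _ = ENNReal.ofReal (2 * (p / L) * δ) := by
          rw [← ENNReal.ofReal_add (by positivity) (by positivity)]
          congr 1; ring
        _ ≤ _ := by
          refine ENNReal.ofReal_le_ofReal ?_
          have : 0 ≤ V / m := div_nonneg ENNReal.toReal_nonneg hm0.le
          gcongr
          linarith
  · calc _ ≤ padicHaar p (Metric.closedBall 0 B) := measure_mono Set.inter_subset_left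
      _ = ENNReal.ofReal V := (ENNReal.ofReal_toReal hVtop).symm
      _ ≤ _ := by
        refine ENNReal.ofReal_le_ofReal ?_
        have hV0 : 0 ≤ V := ENNReal.toReal_nonneg
        have : 0 ≤ 2 * (p / L) := by positivity
        calc V = V / m * m := by field_simp
          _ ≤ V / m * δ := by gcongr
          _ ≤ _ := by gcongr; linarith

/-- The fibres of `ψ` cover a compact ball by open sets, and a Lebesgue number gives a common
radius. Outside the ball a short shift does not change the norm, so both values vanish. -/
theorem exists_uniform_locallyConstant {ψ : ℚ_[p] → ℂ} (hψ : IsLocallyConstant ψ)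
    (hψc : HasCompactSupport ψ) :
    ∃ B ρ : ℝ, 1 ≤ B ∧ 0 < ρ ∧ ρ ≤ 1 ∧ (∀ y, B < ‖y‖ → ψ y = 0) ∧
      ∀ y h, ‖h‖ ≤ ρ → ψ (y + h) = ψ y := by
  obtain ⟨B₀, hB₀⟩ := hψc.isCompact.isBounded.exists_norm_le
  set B := max 1 B₀ with hB
  have hout : ∀ y, B < ‖y‖ → ψ y = 0 := by
    intro y hy
    by_contra h
    have := hB₀ y (subset_tsupport _ h)
    exact absurd (this.trans (le_max_right 1 B₀)) (not_le.2 hy)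
  obtain ⟨δ, hδ, hleb⟩ := lebesgue_number_lemma_of_metric
    (isCompact_closedBall (0 : ℚ_[p]) B) (c := fun v : ℂ => ψ ⁻¹' {v})
    (fun v => hψ.isOpen_fiber v) (fun y _ => Set.mem_iUnion.2 ⟨ψ y, rfl⟩)
  refine ⟨B, min 1 (δ / 2), le_max_left _ _, by positivity, min_le_left _ _, hout, ?_⟩
  intro y h hh
  rcases le_or_gt ‖y‖ B with hy | hy
  · obtain ⟨v, hv⟩ := hleb y (by simpa using hy)
    have h1 : ψ y = v := hv (Metric.mem_ball_self hδ)
    have h2 : ψ (y + h) = v := by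
      refine hv ?_
      rw [Metric.mem_ball, dist_eq_norm, add_sub_cancel_left]
      have := hh.trans (min_le_right _ _)
      linarith
    rw [h1, h2]
  · have hn : ‖y + h‖ = ‖y‖ := norm_eq_of_norm_sub_lt (by
      rw [add_sub_cancel_left]
      exact (hh.trans (min_le_left _ _)).trans_lt ((le_max_left _ _).trans_lt hy))
    rw [hout y hy, hout _ (by rw [hn]; exact hy)]

/-- The shift changes `y ^ 2 - a` by `h * (2 * y + h)`, of norm at most `B * ‖h‖`. -/
theorem norm_sq_shift_sub_le {a y h : ℚ_[p]} {B : ℝ} (hB : 1 ≤ B) (hy : ‖y‖ ≤ B) (hh : ‖h‖ ≤ 1)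
    (hD : B / ‖(8 * p : ℚ_[p])‖ * ‖h‖ ≤ ‖y ^ 2 - a‖) :
    ‖(y + h) ^ 2 - a - (y ^ 2 - a)‖ ≤ ‖(8 * p : ℚ_[p])‖ * ‖y ^ 2 - a‖ := by
  have h8 := norm_eight_mul_pos p
  have h2 : ‖(2 : ℚ_[p])‖ ≤ 1 := by exact_mod_cast Padic.norm_int_le_one (p := p) 2
  rw [show (y + h) ^ 2 - a - (y ^ 2 - a) = h * (2 * y + h) by ring, norm_mul]
  have h1 : ‖2 * y + h‖ ≤ B := by
    refine (Padic.nonarchimedean _ _).trans (max_le ?_ (hh.trans hB))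
    rw [norm_mul]
    nlinarith [norm_nonneg y, norm_nonneg (2 : ℚ_[p])]
  calc ‖h‖ * ‖2 * y + h‖ ≤ ‖h‖ * B := by gcongr
    _ = ‖(8 * p : ℚ_[p])‖ * (B / ‖(8 * p : ℚ_[p])‖ * ‖h‖) := by field_simp
    _ ≤ _ := by gcongr

/-- The set `Y` as a function of `a = 4 N` in `ℚ_p`. -/
def symbolSet (a : ℚ_[p]) (ε : ℤ) : Set ℚ_[p] :=
  {y | y ^ 2 - a ≠ 0 ∧ padicSymbol p (y ^ 2 - a) = ε}

theorem eventually_norm_sub_le (a : ℚ_[p]) {y : ℚ_[p]} (hy : y ^ 2 - a ≠ 0) :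
    ∀ᶠ w in nhds y, ‖w ^ 2 - a - (y ^ 2 - a)‖ ≤ ‖(8 * p : ℚ_[p])‖ * ‖y ^ 2 - a‖ := by
  have hc : Continuous fun w : ℚ_[p] => w ^ 2 - a := by fun_prop
  have := hc.continuousAt (x := y) (Metric.closedBall_mem_nhds _
    (mul_pos (norm_eight_mul_pos p) (norm_pos_iff.2 hy)))
  filter_upwards [this] with w hw
  simpa [dist_eq_norm] using hw

theorem ne_zero_of_norm_sub_le {z w : ℚ_[p]} (hz : z ≠ 0)
    (h : ‖w - z‖ ≤ ‖(8 * p : ℚ_[p])‖ * ‖z‖) : w ≠ 0 := by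
  rw [← norm_pos_iff, norm_eq_of_norm_sub_lt (norm_sub_lt_of_le hz h)]
  exact norm_pos_iff.2 hz

theorem isOpen_symbolSet (a : ℚ_[p]) (ε : ℤ) : IsOpen (symbolSet a ε) := by
  rw [isOpen_iff_mem_nhds]
  rintro y ⟨hy1, hy2⟩
  filter_upwards [eventually_norm_sub_le a hy1] with w hw
  exact ⟨ne_zero_of_norm_sub_le hy1 hw, by rw [padicSymbol_eq_of_norm_sub_le hy1 hw, hy2]⟩

theorem continuousAt_modNorm_sq_sub (a : ℚ_[p]) {y : ℚ_[p]} (hy : y ^ 2 - a ≠ 0) :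
    ContinuousAt (fun y : ℚ_[p] => modNorm p (y ^ 2 - a)) y := by
  refine (continuousAt_const (y := modNorm p (y ^ 2 - a))).congr ?_
  filter_upwards [eventually_norm_sub_le a hy] with w hw
  exact (modNorm_eq_of_norm_sub_le hy hw).symm

theorem continuousOn_modNorm_sq_sub_cpow (a : ℚ_[p]) (ε : ℤ) (b : ℂ) :
    ContinuousOn (fun y : ℚ_[p] => (modNorm p (y ^ 2 - a) : ℂ) ^ b) (symbolSet a ε) := by
  intro y hy
  refine ContinuousAt.continuousWithinAt ?_
  refine ContinuousAt.cpow
    (Complex.continuous_ofReal.continuousAt.comp (continuousAt_modNorm_sq_sub a hy.1))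
    continuousAt_const ?_
  exact Complex.ofReal_mem_slitPlane.2 (modNorm_pos hy.1)

/-- Used twice: with `T` the whole of `symbolSet` it gives integrability and the trivial bound, with
`T` near the zeros of `y ^ 2 - a` it gives the decay in `η`. -/
theorem lintegral_symbolSet_le {κ B Mψ c : ℝ} (hκ : 0 < κ) (hc : -1 < c) (hM : 0 ≤ Mψ) :
    ∃ K : ℝ, 0 ≤ K ∧ ∀ a : ℚ_[p], ‖a‖ = κ → ∀ ψ : ℚ_[p] → ℂ, (∀ y, ‖ψ y‖ ≤ Mψ) →
      (∀ y, B < ‖y‖ → ψ y = 0) → ∀ ε : ℤ, ∀ b : ℂ, b.re = c → ∀ δ : ℝ, 0 < δ →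
      ∀ T : Set ℚ_[p], MeasurableSet T → T ⊆ symbolSet a ε →
      (∀ y ∈ T, ‖y‖ ≤ B → ‖y ^ 2 - a‖ ≤ δ) →
      ∫⁻ y in T, ‖(modNorm p (y ^ 2 - a) : ℂ) ^ b * ψ y‖ₑ ∂(padicHaar p) ≤
        ENNReal.ofReal (K * δ ^ (c + 1)) := by
  obtain ⟨A, hA⟩ := padicHaar_sublevel_le (p := p) (B := B) hκ
  obtain ⟨K, hK, hKb⟩ := lintegral_rpow_sublevel_le (A := A) hc
  set m := max 1 (((p : ℝ) ^ 3) ^ c) with hm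
  have hm0 : 0 ≤ m := le_trans zero_le_one (le_max_left _ _)
  refine ⟨m * Mψ * K, by positivity, ?_⟩
  intro a ha ψ hψM hψB ε b hb δ hδ T hT hTY hTδ
  set S : Set ℚ_[p] := Metric.closedBall 0 B with hS
  set U : Set ℚ_[p] := S ∩ {y | 0 < ‖y ^ 2 - a‖ ∧ ‖y ^ 2 - a‖ ≤ δ} with hU
  have hUm : MeasurableSet U := by
    have hc : Continuous fun w : ℚ_[p] => ‖w ^ 2 - a‖ := by fun_prop
    exact Metric.isClosed_closedBall.measurableSet.inter
      ((measurableSet_lt measurable_const hc.measurable).inter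
        (measurableSet_le hc.measurable measurable_const))
  calc ∫⁻ y in T, ‖(modNorm p (y ^ 2 - a) : ℂ) ^ b * ψ y‖ₑ ∂(padicHaar p)
      ≤ ∫⁻ y in U, ENNReal.ofReal (m * Mψ) * ENNReal.ofReal (‖y ^ 2 - a‖ ^ c) ∂(padicHaar p) := by
        rw [← lintegral_indicator hT, ← lintegral_indicator hUm]
        refine lintegral_mono fun y => ?_
        by_cases hyT : y ∈ T
        · rw [Set.indicator_of_mem hyT]
          have hy0 := (hTY hyT).1
          by_cases hyB : ‖y‖ ≤ B
          · have hyU : y ∈ U := ⟨by simpa [hS] using hyB, norm_pos_iff.2 hy0, hTδ y hyT hyB⟩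
            rw [Set.indicator_of_mem hyU, ← ENNReal.ofReal_mul (by positivity),
              ← ofReal_norm]
            refine ENNReal.ofReal_le_ofReal ?_
            rw [norm_mul, Complex.norm_cpow_eq_rpow_re_of_pos (modNorm_pos hy0), hb]
            calc _ ≤ (m * ‖y ^ 2 - a‖ ^ c) * Mψ := by
                  gcongr
                  · exact modNorm_rpow_le hy0 c
                  · exact hψM y
              _ = _ := by ring
          · rw [hψB y (not_le.1 hyB)]
            simp
        · rw [Set.indicator_of_notMem hyT]; exact zero_le
    _ = ENNReal.ofReal (m * Mψ) * ∫⁻ y in U, ENNReal.ofReal (‖y ^ 2 - a‖ ^ c) ∂(padicHaar p) :=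
        lintegral_const_mul' _ _ ENNReal.ofReal_ne_top
    _ ≤ ENNReal.ofReal (m * Mψ) * ENNReal.ofReal (K * δ ^ (c + 1)) := by
        gcongr
        exact hKb (padicHaar p) (fun y => ‖y ^ 2 - a‖) S (hA a ha) δ hδ
    _ = _ := by
        rw [← ENNReal.ofReal_mul (by positivity)]
        congr 1; ring

/-- At a distance from the zeros of `y ^ 2 - a` governed by `‖h‖`, neither the modified norm nor the
symbol changes under the shift, so the truncated function is genuinely `h`-periodic. -/
theorem modNorm_indicator_add {a h : ℚ_[p]} {ε : ℤ} {b : ℂ} {ψ : ℚ_[p] → ℂ} {B ρ : ℝ}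
    (hB : 1 ≤ B) (hρ : ρ ≤ 1) (hψB : ∀ y, B < ‖y‖ → ψ y = 0)
    (hψρ : ∀ y h, ‖h‖ ≤ ρ → ψ (y + h) = ψ y) (hh : ‖h‖ ≤ ρ) (y : ℚ_[p]) :
    (symbolSet a ε ∩ {y | B / ‖(8 * p : ℚ_[p])‖ * ‖h‖ ≤ ‖y ^ 2 - a‖}).indicator
        (fun y => (modNorm p (y ^ 2 - a) : ℂ) ^ b * ψ y) (y + h) =
      (symbolSet a ε ∩ {y | B / ‖(8 * p : ℚ_[p])‖ * ‖h‖ ≤ ‖y ^ 2 - a‖}).indicator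
        (fun y => (modNorm p (y ^ 2 - a) : ℂ) ^ b * ψ y) y := by
  set S := symbolSet a ε ∩ {y | B / ‖(8 * p : ℚ_[p])‖ * ‖h‖ ≤ ‖y ^ 2 - a‖} with hS
  rcases le_or_gt ‖y‖ B with hy | hy
  · have hstep : ∀ x k : ℚ_[p], ‖x‖ ≤ B → ‖k‖ = ‖h‖ → x ∈ S → x + k ∈ S ∧
        modNorm p ((x + k) ^ 2 - a) = modNorm p (x ^ 2 - a) := by
      rintro x k hx hk ⟨⟨hx1, hx2⟩, hx3⟩
      simp only [Set.mem_ofPred_eq] at hx3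
      rw [← hk] at hx3
      have hle := norm_sq_shift_sub_le hB hx (by rw [hk]; exact hh.trans hρ) hx3
      refine ⟨⟨⟨ne_zero_of_norm_sub_le hx1 hle, ?_⟩, ?_⟩, modNorm_eq_of_norm_sub_le hx1 hle⟩
      · rw [padicSymbol_eq_of_norm_sub_le hx1 hle, hx2]
      · simp only [Set.mem_ofPred_eq]
        rw [norm_eq_of_norm_sub_lt (norm_sub_lt_of_le hx1 hle), ← hk]
        exact hx3
    by_cases hyS : y ∈ S
    · obtain ⟨h1, h2⟩ := hstep y h hy rfl hyS
      rw [Set.indicator_of_mem h1, Set.indicator_of_mem hyS, h2, hψρ y h hh]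
    -- Non-membership is also preserved: shift back by `-h`, which has the same norm and hence the
    -- same truncation.
    · have hyS' : y + h ∉ S := by
        intro hmem
        have hyh : ‖y + h‖ ≤ B :=
          (Padic.nonarchimedean _ _).trans (max_le hy ((hh.trans hρ).trans hB))
        have := (hstep (y + h) (-h) hyh (norm_neg h) hmem).1
        rw [add_neg_cancel_right] at this
        exact hyS this
      rw [Set.indicator_of_notMem hyS, Set.indicator_of_notMem hyS']
  · have hz : ψ y = 0 := hψB y hy
    have hz' : ψ (y + h) = 0 := by rw [hψρ y h hh, hz]
    simp [Set.indicator, hz, hz']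

/-- Translation by `h` multiplies the integral by a number different from `1`. -/
theorem integral_mul_padicE_eq_zero {g : ℚ_[p] → ℂ} {h η : ℚ_[p]} (hg : ∀ y, g (y + h) = g y)
    (hη : padicE p (-(h * η)) ≠ 1) :
    ∫ y, g y * padicE p (-(y * η)) ∂(padicHaar p) = 0 := by
  set I := ∫ y, g y * padicE p (-(y * η)) ∂(padicHaar p) with hI
  have h1 : I = I * padicE p (-(h * η)) := by
    conv_lhs => rw [hI, ← integral_add_right_eq_self _ h]
    rw [hI, ← integral_mul_const]
    refine integral_congr_ae (Eventually.of_forall fun y => ?_)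
    simp only [hg]
    rw [show -((y + h) * η) = -(y * η) + -(h * η) by ring, padicE_add]
    ring
  have h2 : I * (padicE p (-(h * η)) - 1) = 0 := by rw [mul_sub, ← h1]; ring
  exact (mul_eq_zero.1 h2).resolve_right (sub_ne_zero.2 hη)

theorem padic_local_bound {κ c : ℝ} (hκ : 0 < κ) (hc : -1 < c) (ε : ℤ) {ψ : ℚ_[p] → ℂ}
    (hψ : IsLocallyConstant ψ) (hψc : HasCompactSupport ψ) :
    ∃ K : ℝ, 0 ≤ K ∧ ∀ a : ℚ_[p], ‖a‖ = κ → ∀ b : ℂ, b.re = c → ∀ η : ℚ_[p],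
      IntegrableOn (fun y => (modNorm p (y ^ 2 - a) : ℂ) ^ b * ψ y * padicE p (-(y * η)))
        (symbolSet a ε) (padicHaar p) ∧
      ‖∫ y in symbolSet a ε, (modNorm p (y ^ 2 - a) : ℂ) ^ b * ψ y * padicE p (-(y * η))
        ∂(padicHaar p)‖ ≤ K * (1 + ‖η‖) ^ (-1 - c) := by
  obtain ⟨B, ρ, hB, hρ0, hρ1, hψB, hψρ⟩ := exists_uniform_locallyConstant hψ hψc
  obtain ⟨Mψ, hMψ⟩ := hψc.exists_bound_of_continuous hψ.continuous
  have hM0 : 0 ≤ Mψ := (norm_nonneg _).trans (hMψ 0)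
  obtain ⟨K, hK, hKb⟩ := lintegral_symbolSet_le (p := p) (B := B) hκ hc hM0
  obtain ⟨z, hz, hz1⟩ := exists_padicE_ne_one p
  have hp : (1 : ℝ) < p := by exact_mod_cast (Fact.out : p.Prime).one_lt
  have hp0 : (0 : ℝ) < p := zero_lt_one.trans hp
  set A : ℝ := B / ‖(8 * p : ℚ_[p])‖ with hA
  have hA0 : 0 < A := div_pos (by linarith) (norm_eight_mul_pos p)
  -- Bounds `‖y ^ 2 - a‖` on the ball outside which `ψ` vanishes.
  set Δ : ℝ := max (B ^ 2) κ with hΔ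
  have hΔ0 : 0 < Δ := lt_max_of_lt_right hκ
  set R : ℝ := 1 + p / ρ with hR
  have hR0 : 0 < R := by positivity
  -- The first summand serves `‖η‖ ≥ p / ρ`, the second the remaining `η`, where the trivial bound
  -- suffices.
  refine ⟨K * (A * p * 2) ^ (c + 1) + K * (Δ * R) ^ (c + 1), by positivity, ?_⟩
  intro a ha b hb η
  set g : ℚ_[p] → ℂ := fun y => (modNorm p (y ^ 2 - a) : ℂ) ^ b * ψ y with hg
  have hYm : MeasurableSet (symbolSet a ε) := (isOpen_symbolSet a ε).measurableSet
  have hfin := hKb a ha ψ hMψ hψB ε b hb Δ hΔ0 (symbolSet a ε) hYm subset_rfl (by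
    intro y _ hy
    refine (norm_sub_le_max _ _).trans (max_le_max ?_ ha.le)
    rw [norm_pow]; gcongr)
  have hnorm : ∀ y, ‖g y * padicE p (-(y * η))‖ₑ = ‖g y‖ₑ := by
    intro y
    rw [← ofReal_norm, ← ofReal_norm, norm_mul, norm_padicE, mul_one]
  have hint : IntegrableOn (fun y => g y * padicE p (-(y * η))) (symbolSet a ε) (padicHaar p) := by
    refine ⟨ContinuousOn.aestronglyMeasurable ?_ hYm, ?_⟩
    · refine ((continuousOn_modNorm_sq_sub_cpow a ε b).mul hψ.continuous.continuousOn).mul ?_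
      exact ((continuous_padicE p).comp (by fun_prop)).continuousOn
    · rw [HasFiniteIntegral]
      simp only [hnorm]
      exact hfin.trans_lt ENNReal.ofReal_lt_top
  have hle : ∀ T : Set ℚ_[p], ∀ C : ℝ, 0 ≤ C →
      ∫⁻ y in T, ‖g y‖ₑ ∂(padicHaar p) ≤ ENNReal.ofReal C →
      ‖∫ y in T, g y * padicE p (-(y * η)) ∂(padicHaar p)‖ ≤ C := by
    intro T C hC h
    have h1 := enorm_integral_le_lintegral_enorm (μ := (padicHaar p).restrict T)
      (fun y => g y * padicE p (-(y * η)))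
    simp only [hnorm] at h1
    have h2 := h1.trans h
    rw [← ofReal_norm] at h2
    exact (ENNReal.ofReal_le_ofReal_iff hC).1 h2
  refine ⟨hint, ?_⟩
  have hη1 : 0 < 1 + ‖η‖ := by positivity
  have hpow : (1 + ‖η‖) ^ (c + 1) * (1 + ‖η‖) ^ (-1 - c) = 1 := by
    rw [← Real.rpow_add hη1, show c + 1 + (-1 - c) = 0 by ring, Real.rpow_zero]
  rcases le_or_gt (p / ρ) ‖η‖ with hbig | hsmall
  · have hη0 : 0 < ‖η‖ := lt_of_lt_of_le (by positivity) hbig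
    have hηne : η ≠ 0 := norm_pos_iff.1 hη0
    -- Chosen so that `-(h * η) = z`, where the character is nontrivial; `‖η‖ ≥ p / ρ` makes `h`
    -- short enough to leave `ψ` invariant.
    set h : ℚ_[p] := -(z / η) with hh
    have hhn : ‖h‖ = p / ‖η‖ := by rw [hh, norm_neg, norm_div, hz]
    have hhρ : ‖h‖ ≤ ρ := by
      rw [hhn, div_le_iff₀ hη0]
      rw [div_le_iff₀ hρ0] at hbig
      linarith
    have hh0 : h ≠ 0 := by rw [← norm_pos_iff, hhn]; positivity
    have hhη : padicE p (-(h * η)) ≠ 1 := by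
      have : -(h * η) = z := by rw [hh]; field_simp
      rw [this]; exact hz1
    set V : Set ℚ_[p] := {y | A * ‖h‖ ≤ ‖y ^ 2 - a‖} with hV
    have hVm : MeasurableSet V := by
      have hc : Continuous fun w : ℚ_[p] => ‖w ^ 2 - a‖ := by fun_prop
      exact measurableSet_le measurable_const hc.measurable
    have hzero : ∫ y in symbolSet a ε ∩ V, g y * padicE p (-(y * η)) ∂(padicHaar p) = 0 := by
      rw [← integral_indicator (hYm.inter hVm)]
      have h1 := integral_mul_padicE_eq_zero (g := (symbolSet a ε ∩ V).indicator g) (η := η)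
        (modNorm_indicator_add (a := a) (ε := ε) (b := b) hB hρ1 hψB hψρ hhρ) hhη
      rw [← h1]
      refine integral_congr_ae (Eventually.of_forall fun y => ?_)
      by_cases hy : y ∈ symbolSet a ε ∩ V
      · simp only [Set.indicator_of_mem hy]
      · simp only [Set.indicator_of_notMem hy, zero_mul]
    have hsplit := integral_inter_add_sdiff (μ := padicHaar p) hVm hint
    rw [hzero, zero_add] at hsplit
    rw [← hsplit]
    have hAh : 0 < A * ‖h‖ := mul_pos hA0 (norm_pos_iff.2 hh0)
    have hb1 := hKb a ha ψ hMψ hψB ε b hb (A * ‖h‖) hAh (symbolSet a ε \ V) (hYm.diff hVm)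
      Set.sdiff_subset (by
        rintro y ⟨-, hy⟩ -
        simp only [hV, Set.mem_ofPred_eq, not_le] at hy
        exact hy.le)
    refine (hle _ _ (by positivity) hb1).trans ?_
    have hcmp : A * ‖h‖ ≤ A * p * 2 * (1 + ‖η‖)⁻¹ := by
      have h1 : (1 : ℝ) ≤ ‖η‖ := le_trans (by
        rw [le_div_iff₀ hρ0]; linarith) hbig
      rw [hhn, ← div_eq_mul_inv, le_div_iff₀ hη1]
      have : A * (p / ‖η‖) * (1 + ‖η‖) = A * p * ((1 + ‖η‖) / ‖η‖) := by ring
      rw [this]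
      gcongr
      rw [div_le_iff₀ hη0]; linarith
    calc K * (A * ‖h‖) ^ (c + 1) ≤ K * (A * p * 2 * (1 + ‖η‖)⁻¹) ^ (c + 1) := by
          gcongr; linarith
      _ = K * (A * p * 2) ^ (c + 1) * (1 + ‖η‖) ^ (-1 - c) := by
          rw [Real.mul_rpow (by positivity) (by positivity), Real.inv_rpow hη1.le,
            ← Real.rpow_neg hη1.le, show -(c + 1) = -1 - c by ring]
          ring
      _ ≤ _ := by
          gcongr
          have : 0 ≤ K * (Δ * R) ^ (c + 1) := by positivity
          linarith
  · refine (hle _ _ (by positivity) hfin).trans ?_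
    have h1 : (1 + ‖η‖) ^ (c + 1) ≤ R ^ (c + 1) :=
      Real.rpow_le_rpow hη1.le (by linarith) (by linarith)
    calc K * Δ ^ (c + 1) = K * Δ ^ (c + 1) * ((1 + ‖η‖) ^ (c + 1) * (1 + ‖η‖) ^ (-1 - c)) := by
          rw [hpow, mul_one]
      _ ≤ K * Δ ^ (c + 1) * (R ^ (c + 1) * (1 + ‖η‖) ^ (-1 - c)) := by gcongr
      _ = K * (Δ * R) ^ (c + 1) * (1 + ‖η‖) ^ (-1 - c) := by
          rw [Real.mul_rpow hΔ0.le hR0.le]; ring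
      _ ≤ _ := by
          gcongr
          have : 0 ≤ K * (A * p * 2) ^ (c + 1) := by positivity
          linarith

end PadicLocal

/-! ### Mellin inversion on every vertical line -/

theorem integrable_vertical {F : ℂ → ℂ} (hF : DifferentiableOn ℂ F {s | 0 < s.re}) {σ B : ℝ}
    (hσ : 0 < σ) (hB : ∀ y : ℝ, (1 + y ^ 2) * ‖F (σ + y * Complex.I)‖ ≤ B) :
    Integrable fun y : ℝ => F (σ + y * Complex.I) := by
  have hcont : Continuous fun y : ℝ => F (σ + y * Complex.I) := by
    refine hF.continuousOn.comp_continuous (by fun_prop) fun y => ?_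
    simpa using hσ
  refine (integrable_inv_one_add_sq.const_mul B).mono' hcont.aestronglyMeasurable
    (Eventually.of_forall fun y => ?_)
  rw [← div_eq_mul_inv, le_div_iff₀ (by positivity), mul_comm]
  exact hB y

/-- Cauchy's theorem on rectangles of height `2T`: the horizontal sides have fixed length and carry
an integrand `O(1 / T²)`. -/
theorem integral_vertical_eq {F : ℂ → ℂ} (hF : DifferentiableOn ℂ F {s | 0 < s.re})
    {σ₁ σ₂ B : ℝ} (hσ : 0 < σ₁) (hσ₂ : σ₁ ≤ σ₂)
    (hB : ∀ s : ℂ, σ₁ ≤ s.re → s.re ≤ σ₂ → (1 + s.im ^ 2) * ‖F s‖ ≤ B) :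
    ∫ y : ℝ, F (σ₁ + y * Complex.I) = ∫ y : ℝ, F (σ₂ + y * Complex.I) := by
  have hi₁ := integrable_vertical hF hσ (B := B) fun y => by
    simpa using hB (σ₁ + y * Complex.I) (by simp) (by simpa using hσ₂)
  have hi₂ := integrable_vertical hF (hσ.trans_le hσ₂) (B := B) fun y => by
    simpa using hB (σ₂ + y * Complex.I) (by simpa using hσ₂) (by simp)
  -- `u T` stands for `T` or `-T`, so both horizontal sides are treated at once.
  have hhor : ∀ u : ℝ → ℝ, (∀ T, u T ^ 2 = T ^ 2) → Tendsto
      (fun T : ℝ => ∫ x : ℝ in σ₁..σ₂, F (x + (u T : ℝ) * Complex.I)) atTop (nhds 0) := by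
    intro u hu
    have hlim : Tendsto (fun T : ℝ => B / (1 + T ^ 2) * |σ₂ - σ₁|) atTop (nhds 0) := by
      rw [← zero_mul |σ₂ - σ₁|]
      refine Tendsto.mul_const _ (Tendsto.const_div_atTop ?_ _)
      exact tendsto_atTop_add_const_left _ _ (tendsto_pow_atTop two_ne_zero)
    refine squeeze_zero_norm (fun T => ?_) hlim
    refine intervalIntegral.norm_integral_le_of_norm_le_const fun x hx => ?_
    rw [Set.uIoc_of_le hσ₂] at hx
    rw [le_div_iff₀ (by positivity), mul_comm, ← hu T]
    simpa using hB (x + (u T : ℝ) * Complex.I) (by simpa using hx.1.le) (by simpa using hx.2)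
  have hrect : ∀ T : ℝ, (∫ x : ℝ in σ₁..σ₂, F (x + ((-T : ℝ) : ℂ) * Complex.I)) -
      (∫ x : ℝ in σ₁..σ₂, F (x + (T : ℝ) * Complex.I)) +
      Complex.I • (∫ y : ℝ in (-T)..T, F (σ₂ + y * Complex.I)) -
      Complex.I • (∫ y : ℝ in (-T)..T, F (σ₁ + y * Complex.I)) = 0 := by
    intro T
    have := Complex.integral_boundary_rect_eq_zero_of_differentiableOn F
      (σ₁ + ((-T : ℝ) : ℂ) * Complex.I) (σ₂ + (T : ℂ) * Complex.I) (hF.mono (by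
        intro s hs
        have h1 := (Complex.mem_reProdIm.1 hs).1
        simp only [Complex.add_re, Complex.ofReal_re, Complex.mul_re, Complex.I_re, mul_zero,
          Complex.ofReal_im, Complex.I_im, mul_one, sub_self, add_zero] at h1
        rw [Set.uIcc_of_le hσ₂] at h1
        exact hσ.trans_le h1.1))
    simpa using this
  have hlim := (((hhor (fun T => -T) (by simp)).sub (hhor (fun T => T) (by simp))).add
    ((intervalIntegral_tendsto_integral hi₂ tendsto_neg_atTop_atBot tendsto_id).const_smul
      Complex.I)).sub
    ((intervalIntegral_tendsto_integral hi₁ tendsto_neg_atTop_atBot tendsto_id).const_smul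
      Complex.I)
  have h0 := tendsto_nhds_unique hlim (tendsto_const_nhds.congr fun T => (hrect T).symm)
  rw [sub_self, zero_add, ← smul_sub, smul_eq_zero] at h0
  exact (sub_eq_zero.1 (h0.resolve_left Complex.I_ne_zero)).symm

theorem exists_mul_norm_le_of_rapid {G : ℂ → ℂ} (hdec : ∀ σ₁ σ₂ : ℝ, 0 < σ₁ → ∀ k : ℕ, ∃ B : ℝ,
    ∀ s : ℂ, σ₁ ≤ s.re → s.re ≤ σ₂ → |s.im| ^ k * ‖G s‖ ≤ B) {σ₁ σ₂ : ℝ} (hσ : 0 < σ₁) (k : ℕ) :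
    ∃ B : ℝ, ∀ s : ℂ, σ₁ ≤ s.re → s.re ≤ σ₂ →
      (1 + s.im ^ 2) * ((1 + |s.im|) ^ k * ‖G s‖) ≤ B := by
  obtain ⟨B₀, hB₀⟩ := hdec σ₁ σ₂ hσ 0
  obtain ⟨B₁, hB₁⟩ := hdec σ₁ σ₂ hσ (k + 2)
  refine ⟨2 ^ (k + 2) * (B₀ + B₁), fun s h1 h2 => ?_⟩
  have hb0 := hB₀ s h1 h2
  have hb1 := hB₁ s h1 h2
  rw [pow_zero, one_mul] at hb0
  have hx := abs_nonneg s.im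
  have h3 : 1 + s.im ^ 2 ≤ (1 + |s.im|) ^ 2 := by rw [← sq_abs]; nlinarith
  have h4 : (1 + |s.im|) ^ (k + 2) ≤ 2 ^ (k + 2) * (1 + |s.im| ^ (k + 2)) := by
    rcases le_total |s.im| 1 with h | h
    · calc (1 + |s.im|) ^ (k + 2) ≤ 2 ^ (k + 2) := by gcongr; linarith
        _ ≤ _ := le_mul_of_one_le_right (by positivity) (by
          have := pow_nonneg hx (k + 2); linarith)
    · calc (1 + |s.im|) ^ (k + 2) ≤ (2 * |s.im|) ^ (k + 2) := by gcongr; linarith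
        _ = 2 ^ (k + 2) * |s.im| ^ (k + 2) := mul_pow _ _ _
        _ ≤ _ := by gcongr; linarith
  calc (1 + s.im ^ 2) * ((1 + |s.im|) ^ k * ‖G s‖)
      ≤ (1 + |s.im|) ^ 2 * ((1 + |s.im|) ^ k * ‖G s‖) := by gcongr
    _ = (1 + |s.im|) ^ (k + 2) * ‖G s‖ := by ring
    _ ≤ 2 ^ (k + 2) * (1 + |s.im| ^ (k + 2)) * ‖G s‖ := by gcongr
    _ = 2 ^ (k + 2) * (‖G s‖ + |s.im| ^ (k + 2) * ‖G s‖) := by ring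
    _ ≤ _ := by gcongr

/-- Inversion applies where the Mellin integral converges absolutely, on a line `σ₂ > σ₀`. The line
is then moved back to `σ`, where only the continuation `G` is available. -/
theorem exists_mellin_inversion {Φ : ℝ → ℂ} (hΦ : ContinuousOn Φ (Set.Ioi 0))
    (hΦM : MellinRapid Φ) {σ : ℝ} (hσ : 0 < σ) :
    ∃ g : ℝ → ℂ, Continuous g ∧ (∀ k : ℕ, Integrable fun y => (1 + |y|) ^ k * ‖g y‖) ∧
      ∀ t : ℝ, 0 < t → Φ t = ∫ y : ℝ, g y * (t : ℂ) ^ (-(σ + y * Complex.I)) := by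
  obtain ⟨G, hG, ⟨σ₀, hσ₀, hM⟩, hdec⟩ := hΦM
  have hGc : Continuous fun y : ℝ => G (σ + y * Complex.I) := by
    refine hG.continuousOn.comp_continuous (by fun_prop) fun y => ?_
    simpa using hσ
  refine ⟨fun y => (1 / (2 * Real.pi) : ℝ) * G (σ + y * Complex.I),
    continuous_const.mul hGc, ?_, ?_⟩
  · intro k
    obtain ⟨B, hB⟩ := exists_mul_norm_le_of_rapid hdec (σ₂ := σ) hσ k
    refine ((integrable_inv_one_add_sq.const_mul B).const_mul (1 / (2 * Real.pi))).mono'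
      (((continuous_const.add continuous_abs).pow k).mul
        (continuous_const.mul hGc).norm).aestronglyMeasurable (Eventually.of_forall fun y => ?_)
    have h := hB (σ + y * Complex.I) (by simp) (by simp)
    simp only [Complex.add_im, Complex.ofReal_im, Complex.mul_im, Complex.ofReal_re, Complex.I_im,
      mul_one, Complex.I_re, mul_zero, add_zero, zero_add] at h
    have hpi : (0 : ℝ) ≤ 1 / (2 * Real.pi) := by positivity
    rw [Real.norm_of_nonneg (by positivity), norm_mul, Complex.norm_real,
      Real.norm_of_nonneg hpi]
    have h2 : (1 + |y|) ^ k * ‖G (σ + y * Complex.I)‖ ≤ B * (1 + y ^ 2)⁻¹ := by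
      rw [← div_eq_mul_inv, le_div_iff₀ (by positivity), mul_comm]
      exact h
    calc _ = 1 / (2 * Real.pi) * ((1 + |y|) ^ k * ‖G (σ + y * Complex.I)‖) := by ring
      _ ≤ _ := by gcongr
  · intro t ht
    have ht0 : (t : ℂ) ≠ 0 := by exact_mod_cast ht.ne'
    set F : ℂ → ℂ := fun s => G s * (t : ℂ) ^ (-s) with hF
    have hFd : DifferentiableOn ℂ F {s | 0 < s.re} := by
      refine hG.mul fun s _ => ?_
      exact (DifferentiableAt.const_cpow (by fun_prop) (Or.inl ht0)).differentiableWithinAt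
    set σ₂ := max σ (σ₀ + 1) with hσ₂
    obtain ⟨B, hB⟩ := exists_mul_norm_le_of_rapid hdec (σ₂ := σ₂) hσ 0
    have hFB : ∀ s : ℂ, σ ≤ s.re → s.re ≤ σ₂ →
        (1 + s.im ^ 2) * ‖F s‖ ≤ B * (t ^ (-σ) + t ^ (-σ₂)) := by
      intro s h1 h2
      have h3 := hB s h1 h2
      rw [pow_zero, one_mul] at h3
      -- `t ^ (-Re s)` is monotone in `Re s`, so the two edge values together dominate it, whether
      -- `t` is below or above `1`.
      have h4 : ‖(t : ℂ) ^ (-s)‖ ≤ t ^ (-σ) + t ^ (-σ₂) := by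
        rw [Complex.norm_cpow_eq_rpow_re_of_pos ht, Complex.neg_re]
        have ha : 0 < t ^ (-σ) := by positivity
        have hb : 0 < t ^ (-σ₂) := by positivity
        rcases le_total t 1 with h | h
        · have := Real.rpow_le_rpow_of_exponent_ge ht h (neg_le_neg h2)
          linarith
        · have := Real.rpow_le_rpow_of_exponent_le h (neg_le_neg h1)
          linarith
      rw [hF, norm_mul]
      calc _ = (1 + s.im ^ 2) * ‖G s‖ * ‖(t : ℂ) ^ (-s)‖ := by ring
        _ ≤ _ := by
          gcongr
          exact (by positivity : (0 : ℝ) ≤ (1 + s.im ^ 2) * ‖G s‖).trans h3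
    have hshift := integral_vertical_eq hFd hσ (le_max_left _ _) hFB
    have hσ₂0 : σ₀ < σ₂ := lt_of_lt_of_le (by linarith) (le_max_right _ _)
    have hmel : ∀ y : ℝ, mellin Φ (σ₂ + y * Complex.I) = G (σ₂ + y * Complex.I) := fun y =>
      (hM _ (by simpa using hσ₂0)).2
    have hinv := mellinInv_mellin_eq σ₂ Φ ht (hM σ₂ (by simpa using hσ₂0)).1 (by
      rw [Complex.VerticalIntegrable]
      simp only [hmel]
      refine integrable_vertical hG (hσ₀.trans_lt hσ₂0) (B := B) fun y => ?_
      simpa using hB (σ₂ + y * Complex.I) (by simp [hσ₂]) (by simp))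
      (hΦ.continuousAt (Ioi_mem_nhds ht))
    rw [← hinv, mellinInv]
    simp only [hmel, smul_eq_mul]
    have h5 : ∀ y : ℝ, (t : ℂ) ^ (-((σ₂ : ℂ) + y * Complex.I)) * G (σ₂ + y * Complex.I) =
        F (σ₂ + y * Complex.I) := fun y => mul_comm _ _
    have h6 : ∀ y : ℝ, ((1 / (2 * Real.pi) : ℝ) : ℂ) * G (σ + y * Complex.I) *
        (t : ℂ) ^ (-((σ : ℂ) + y * Complex.I)) =
        ((1 / (2 * Real.pi) : ℝ) : ℂ) * F (σ + y * Complex.I) := fun y => mul_assoc _ _ _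
    simp only [h5, h6]
    rw [integral_const_mul, hshift, Complex.real_smul]

/-! ### Oscillatory integrals with algebraic singularities at the end points -/

theorem integral_rpow_le_of_lt_neg_one {c a b : ℝ} (hc : c < -1) (ha : 0 < a) (hab : a ≤ b) :
    ∫ t in a..b, t ^ c ≤ (-(c + 1))⁻¹ * a ^ (c + 1) := by
  rw [integral_rpow (Or.inr ⟨by linarith, by
    rw [Set.uIcc_of_le hab]; exact fun h => absurd h.1 (not_le.2 ha)⟩)]
  have h1 : 0 < b ^ (c + 1) := Real.rpow_pos_of_pos (ha.trans_le hab) _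
  have h2 : 0 < -(c + 1) := by linarith
  rw [inv_mul_eq_div, ← neg_div_neg_eq]
  gcongr
  linarith

/-- The term `δ ^ (-1/2)` gives one shape for all `c`: it absorbs the logarithm at `c = -1` and the
bounded integrals for `c > -1`. The loss is harmless, as further integrations by parts supply powers
of `δ`. -/
theorem integral_rpow_truncated_le (c : ℝ) {L : ℝ} (hL : 0 < L) :
    ∃ K : ℝ, 0 ≤ K ∧ ∀ δ b : ℝ, 0 < δ → δ ≤ b → b ≤ L →
      ∫ t in δ..b, t ^ c ≤ K * (δ ^ (c + 1) + δ ^ (-(1 / 2) : ℝ)) := by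
  rcases lt_or_ge c (-1) with hc | hc
  · refine ⟨(-(c + 1))⁻¹, inv_nonneg.2 (by linarith), fun δ b hδ hb _ => ?_⟩
    have h0 : 0 ≤ (-(c + 1))⁻¹ := inv_nonneg.2 (by linarith)
    refine (integral_rpow_le_of_lt_neg_one hc hδ hb).trans ?_
    gcongr
    have := Real.rpow_pos_of_pos hδ (-(1 / 2))
    linarith
  · refine ⟨L ^ (c + 3 / 2) * 2, by positivity, fun δ b hδ hb hbL => ?_⟩
    have hnot : (0 : ℝ) ∉ Set.uIcc δ b := by
      rw [Set.uIcc_of_le hb]; exact fun h => absurd h.1 (not_le.2 hδ)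
    have h1 : ∫ t in δ..b, t ^ c ≤ ∫ t in δ..b, L ^ (c + 3 / 2) * t ^ (-(3 / 2) : ℝ) := by
      refine intervalIntegral.integral_mono_on hb
        (intervalIntegral.intervalIntegrable_rpow (Or.inr hnot))
        ((intervalIntegral.intervalIntegrable_rpow (Or.inr hnot)).const_mul _) fun t ht => ?_
      have ht0 : 0 < t := hδ.trans_le ht.1
      calc t ^ c = t ^ (c + 3 / 2) * t ^ (-(3 / 2) : ℝ) := by
            rw [← Real.rpow_add ht0]; congr 1; ring
        _ ≤ _ := by
            gcongr
            · linarith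
            · exact ht.2.trans hbL
    refine h1.trans ?_
    rw [intervalIntegral.integral_const_mul]
    have h2 := integral_rpow_le_of_lt_neg_one (c := -(3 / 2)) (by norm_num) hδ hb
    norm_num at h2
    have h3 := Real.rpow_pos_of_pos hδ (c + 1)
    calc _ ≤ L ^ (c + 3 / 2) * (2 * δ ^ (-(1 / 2) : ℝ)) := by
          gcongr
      _ = L ^ (c + 3 / 2) * 2 * δ ^ (-(1 / 2) : ℝ) := by ring
      _ ≤ _ := by gcongr; linarith

/-- A smooth weight `w` on `(u, v)` which, on `[-R, R]`, is comparable with the distance to the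
end points. -/
structure IsEdgeWeight (u v R c₁ c₂ : ℝ) (w : ℝ → ℝ) : Prop where
  lt : u < v
  pos₁ : 0 < c₁
  pos₂ : 0 < c₂
  smooth : ContDiff ℝ ∞ w
  pos : ∀ x ∈ Set.Ioo u v, 0 < w x
  ge : ∀ x ∈ Set.Ioo u v, |x| ≤ R → c₁ * min (x - u) (v - x) ≤ w x
  le : ∀ x ∈ Set.Ioo u v, |x| ≤ R → w x ≤ c₂ * min (x - u) (v - x)

/-- Functions smooth on `[u, v]` that vanish on `(u, v)` outside `[-R, R]`. -/
def EdgeTest (u v R : ℝ) (f : ℝ → ℂ) : Prop :=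
  ContDiffOn ℝ ∞ f (Set.Icc u v) ∧ ∀ x ∈ Set.Ioo u v, R < |x| → f x = 0

/-! ### Integration by parts away from the end points. -/

section Edge

variable {u v R c₁ c₂ : ℝ} {w : ℝ → ℝ}

theorem EdgeTest.derivWithin (huv : u < v) {f : ℝ → ℂ} (hf : EdgeTest u v R f) :
    EdgeTest u v R (derivWithin f (Set.Icc u v)) := by
  refine ⟨hf.1.derivWithin (uniqueDiffOn_Icc huv) (by simp), fun x hx hR => ?_⟩
  rw [derivWithin_of_mem_nhds (Icc_mem_nhds hx.1 hx.2)]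
  have : f =ᶠ[nhds x] fun _ => 0 := by
    filter_upwards [Ioo_mem_nhds hx.1 hx.2, (isOpen_lt continuous_const continuous_abs).mem_nhds hR]
      with y hy hyR
    exact hf.2 y hy hyR
  rw [this.deriv_eq, deriv_const]

theorem EdgeTest.mul_deriv {f : ℝ → ℂ} (hf : EdgeTest u v R f) (hw : ContDiff ℝ ∞ w) :
    EdgeTest u v R (fun x => ((deriv w x : ℝ) : ℂ) * f x) := by
  refine ⟨ContDiffOn.mul ?_ hf.1, fun x hx hR => by simp [hf.2 x hx hR]⟩
  have h1 : ContDiff ℝ ∞ (deriv w) := (contDiff_infty_iff_deriv.1 hw).2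
  exact (Complex.ofRealCLM.contDiff.comp h1).contDiffOn

theorem EdgeTest.exists_bound {f : ℝ → ℂ} (hf : EdgeTest u v R f) :
    ∃ B : ℝ, 0 ≤ B ∧ ∀ x ∈ Set.Icc u v, ‖f x‖ ≤ B := by
  obtain ⟨B, hB⟩ := isCompact_Icc.exists_bound_of_continuousOn hf.1.continuousOn
  exact ⟨max B 0, le_max_right _ _, fun x hx => (hB x hx).trans (le_max_left _ _)⟩

theorem min_rpow_le {a b : ℝ} (ha : 0 < a) (hb : 0 < b) (c : ℝ) :
    min a b ^ c ≤ a ^ c + b ^ c := by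
  have h1 := Real.rpow_pos_of_pos ha c
  have h2 := Real.rpow_pos_of_pos hb c
  rcases min_choice a b with h | h <;> rw [h] <;> linarith

/-- Beyond `R` the test function vanishes, so comparability of `w` with the distance is needed only
on `[-R, R]`. The bound does not involve the imaginary part of `b`. -/
theorem IsEdgeWeight.exists_norm_le (hw : IsEdgeWeight u v R c₁ c₂ w) {f : ℝ → ℂ}
    (hf : EdgeTest u v R f) (c : ℝ) :
    ∃ K : ℝ, 0 ≤ K ∧ ∀ b : ℂ, b.re = c → ∀ ξ : ℝ, ∀ x ∈ Set.Ioo u v,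
      ‖(w x : ℂ) ^ b * f x * e (-(x * ξ))‖ ≤ K * min (x - u) (v - x) ^ c := by
  obtain ⟨B, hB0, hB⟩ := hf.exists_bound
  have hc₁ := hw.pos₁
  have hc₂ := hw.pos₂
  refine ⟨(c₁ ^ c + c₂ ^ c) * B, by positivity, fun b hb ξ x hx => ?_⟩
  have hd : 0 < min (x - u) (v - x) := lt_min (by linarith [hx.1]) (by linarith [hx.2])
  have hwx := hw.pos x hx
  rw [norm_mul, norm_e, mul_one, norm_mul, Complex.norm_cpow_eq_rpow_re_of_pos hwx, hb]
  rcases le_or_gt |x| R with hR | hR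
  · have h1 : w x ^ c ≤ (c₁ ^ c + c₂ ^ c) * min (x - u) (v - x) ^ c := by
      have ha : 0 < c₁ ^ c := by positivity
      have hb : 0 < c₂ ^ c := by positivity
      rcases le_total 0 c with h | h
      · calc w x ^ c ≤ (c₂ * min (x - u) (v - x)) ^ c :=
              Real.rpow_le_rpow hwx.le (hw.le x hx hR) h
          _ = c₂ ^ c * min (x - u) (v - x) ^ c := Real.mul_rpow hc₂.le hd.le
          _ ≤ _ := by gcongr; linarith
      · calc w x ^ c ≤ (c₁ * min (x - u) (v - x)) ^ c :=
              Real.rpow_le_rpow_of_nonpos (by positivity) (hw.ge x hx hR) h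
          _ = c₁ ^ c * min (x - u) (v - x) ^ c := Real.mul_rpow hc₁.le hd.le
          _ ≤ _ := by gcongr; linarith
    calc _ ≤ (c₁ ^ c + c₂ ^ c) * min (x - u) (v - x) ^ c * B := by
          gcongr
          exact hB x ⟨hx.1.le, hx.2.le⟩
      _ = _ := by ring
  · rw [hf.2 x hx hR, norm_zero, mul_zero]
    positivity

theorem continuous_e_mul (ξ : ℝ) : Continuous fun x : ℝ => e (-(x * ξ)) := by
  unfold e
  fun_prop

theorem IsEdgeWeight.continuousOn (hw : IsEdgeWeight u v R c₁ c₂ w) {f : ℝ → ℂ}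
    (hf : EdgeTest u v R f) (b : ℂ) (ξ : ℝ) :
    ContinuousOn (fun x => (w x : ℂ) ^ b * f x * e (-(x * ξ))) (Set.Ioo u v) := by
  refine ((ContinuousOn.cpow ?_ continuousOn_const ?_).mul
    (hf.1.continuousOn.mono Set.Ioo_subset_Icc_self)).mul (continuous_e_mul ξ).continuousOn
  · exact (Complex.continuous_ofReal.comp hw.smooth.continuous).continuousOn
  · intro x hx
    exact Complex.ofReal_mem_slitPlane.2 (hw.pos x hx)

theorem IsEdgeWeight.truncated_bound_zero (hw : IsEdgeWeight u v R c₁ c₂ w) {f : ℝ → ℂ}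
    (hf : EdgeTest u v R f) (c : ℝ) :
    ∃ K : ℝ, 0 ≤ K ∧ ∀ b : ℂ, b.re = c → ∀ ξ δ : ℝ, 0 < δ → δ < (v - u) / 2 →
      ‖∫ x in (u + δ)..(v - δ), (w x : ℂ) ^ b * f x * e (-(x * ξ))‖ ≤
        K * (δ ^ (c + 1) + δ ^ (-(1 / 2) : ℝ)) := by
  obtain ⟨K₁, hK₁, h₁⟩ := hw.exists_norm_le hf c
  have huv := hw.lt
  obtain ⟨K₂, hK₂, h₂⟩ := integral_rpow_truncated_le c (sub_pos.2 huv)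
  refine ⟨K₁ * (2 * K₂), by positivity, fun b hb ξ δ hδ hδ2 => ?_⟩
  have hle : u + δ ≤ v - δ := by linarith
  have hnot : (0 : ℝ) ∉ Set.uIcc δ (v - δ - u) := by
    rw [Set.uIcc_of_le (by linarith)]; exact fun h => absurd h.1 (not_le.2 hδ)
  have hI : IntervalIntegrable (fun t : ℝ => t ^ c) volume δ (v - δ - u) :=
    intervalIntegral.intervalIntegrable_rpow (Or.inr hnot)
  have hcongr : ∀ x ∈ Set.Ioc (u + δ) (v - δ), x ∈ Set.Ioo u v := fun x hx =>
    ⟨by linarith [hx.1], by linarith [hx.2]⟩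
  have hI₁ : IntervalIntegrable (fun x : ℝ => (x - u) ^ c) volume (u + δ) (v - δ) := by
    have := hI.comp_sub_right u
    convert this using 1 <;> ring
  have hI₂ : IntervalIntegrable (fun x : ℝ => (v - x) ^ c) volume (u + δ) (v - δ) := by
    have := (hI.comp_sub_left v).symm
    convert this using 1; ring
  have hbd := intervalIntegral.norm_integral_le_of_norm_le hle (μ := volume)
    (f := fun x => (w x : ℂ) ^ b * f x * e (-(x * ξ)))
    (g := fun x => K₁ * ((x - u) ^ c + (v - x) ^ c)) (Eventually.of_forall fun x hx => by
      have hx' := hcongr x hx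
      refine (h₁ b hb ξ x hx').trans ?_
      gcongr
      exact min_rpow_le (by linarith [hx'.1]) (by linarith [hx'.2]) c)
    ((hI₁.add hI₂).const_mul _)
  refine hbd.trans ?_
  rw [intervalIntegral.integral_const_mul, intervalIntegral.integral_add hI₁ hI₂,
    intervalIntegral.integral_comp_sub_right (fun t => t ^ c) u,
    intervalIntegral.integral_comp_sub_left (fun t => t ^ c) v, mul_assoc]
  gcongr
  have e1 : u + δ - u = δ := by ring
  have e2 : v - (v - δ) = δ := by ring
  have e3 : v - (u + δ) = v - δ - u := by ring
  rw [e1, e2, e3]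
  have := h₂ δ (v - δ - u) hδ (by linarith) (by linarith)
  linarith

theorem IsEdgeWeight.hasDerivAt (hw : IsEdgeWeight u v R c₁ c₂ w) {f : ℝ → ℂ}
    (hf : EdgeTest u v R f) (b : ℂ) (ξ : ℝ) {x : ℝ} (hx : x ∈ Set.Ioo u v) :
    HasDerivAt (fun x => (w x : ℂ) ^ b * f x * e (-(x * ξ)))
      (b * ((w x : ℂ) ^ (b - 1) * (((deriv w x : ℝ) : ℂ) * f x) * e (-(x * ξ))) +
        (w x : ℂ) ^ b * derivWithin f (Set.Icc u v) x * e (-(x * ξ)) -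
        2 * Real.pi * Complex.I * ξ * ((w x : ℂ) ^ b * f x * e (-(x * ξ)))) x := by
  have hwx := hw.pos x hx
  have h1 : HasDerivAt (fun x => (w x : ℂ)) ((deriv w x : ℝ) : ℂ) x :=
    ((hw.smooth.differentiable (by simp)).differentiableAt.hasDerivAt).ofReal_comp
  have h2 : HasDerivAt (fun x => (w x : ℂ) ^ b)
      (b * (w x : ℂ) ^ (b - 1) * ((deriv w x : ℝ) : ℂ)) x := by
    have h2' := ((hasDerivAt_id (w x : ℂ)).cpow_const (c := b)
      (Complex.ofReal_mem_slitPlane.2 hwx)).comp x h1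
    exact h2'.congr_deriv (by simp)
  have h3 : HasDerivAt f (derivWithin f (Set.Icc u v) x) x := by
    have hd : DifferentiableAt ℝ f x :=
      (hf.1.differentiableOn (by simp)).differentiableAt (Icc_mem_nhds hx.1 hx.2)
    rw [derivWithin_of_mem_nhds (Icc_mem_nhds hx.1 hx.2)]
    exact hd.hasDerivAt
  have h4 : HasDerivAt (fun x : ℝ => e (-(x * ξ)))
      (e (-(x * ξ)) * (2 * Real.pi * Complex.I * ((-(1 * ξ) : ℝ) : ℂ))) x := by
    have h5 : HasDerivAt (fun x : ℝ => ((-(x * ξ) : ℝ) : ℂ)) ((-(1 * ξ) : ℝ) : ℂ) x :=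
      (((hasDerivAt_id x).mul_const ξ).neg).ofReal_comp
    exact (h5.const_mul (2 * Real.pi * Complex.I)).cexp
  refine ((h2.mul h3).mul h4).congr_deriv ?_
  simp only [Pi.mul_apply]
  push_cast
  ring

theorem IsEdgeWeight.integral_by_parts (hw : IsEdgeWeight u v R c₁ c₂ w) {f : ℝ → ℂ}
    (hf : EdgeTest u v R f) (b : ℂ) (ξ : ℝ) {δ : ℝ} (hδ : 0 < δ) (hδ2 : δ < (v - u) / 2) :
    2 * Real.pi * Complex.I * ξ *
        ∫ x in (u + δ)..(v - δ), (w x : ℂ) ^ b * f x * e (-(x * ξ)) =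
      b * (∫ x in (u + δ)..(v - δ),
        (w x : ℂ) ^ (b - 1) * (((deriv w x : ℝ) : ℂ) * f x) * e (-(x * ξ))) +
      (∫ x in (u + δ)..(v - δ),
        (w x : ℂ) ^ b * derivWithin f (Set.Icc u v) x * e (-(x * ξ))) -
      ((w (v - δ) : ℂ) ^ b * f (v - δ) * e (-((v - δ) * ξ)) -
        (w (u + δ) : ℂ) ^ b * f (u + δ) * e (-((u + δ) * ξ))) := by
  have hsub : Set.uIcc (u + δ) (v - δ) ⊆ Set.Ioo u v := by
    rw [Set.uIcc_of_le (by linarith)]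
    exact fun x hx => ⟨by linarith [hx.1], by linarith [hx.2]⟩
  have hI : ∀ {g : ℝ → ℂ} (_ : EdgeTest u v R g) (b : ℂ), IntervalIntegrable
      (fun x => (w x : ℂ) ^ b * g x * e (-(x * ξ))) volume (u + δ) (v - δ) := fun hg b =>
    ((hw.continuousOn hg b ξ).mono hsub).intervalIntegrable
  have i1 := (hI (hf.mul_deriv hw.smooth) (b - 1)).const_mul b
  have i2 := hI (hf.derivWithin hw.lt) b
  have i3 := (hI hf b).const_mul (2 * Real.pi * Complex.I * ξ)
  have h := intervalIntegral.integral_eq_sub_of_hasDerivAt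
    (fun x hx => hw.hasDerivAt hf b ξ (hsub hx)) ((i1.add i2).sub i3)
  rw [intervalIntegral.integral_sub (i1.add i2) i3, intervalIntegral.integral_add i1 i2,
    intervalIntegral.integral_const_mul, intervalIntegral.integral_const_mul] at h
  rw [← h]
  ring

/-- Each integration by parts gains `δ = |ξ|⁻¹`. Differentiating `w ^ b` lowers `c` by one and costs
a factor `b`, differentiating `f` keeps `c`, and the boundary terms have size `δ ^ c`. The induction
therefore runs over all `c` and `f` simultaneously. -/
theorem IsEdgeWeight.truncated_bound (hw : IsEdgeWeight u v R c₁ c₂ w) (k : ℕ) :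
    ∀ (c : ℝ) (f : ℝ → ℂ), EdgeTest u v R f →
    ∃ K : ℝ, 0 ≤ K ∧ ∀ b : ℂ, b.re = c → ∀ ξ : ℝ, 1 ≤ |ξ| → |ξ|⁻¹ < (v - u) / 2 →
      ‖∫ x in (u + |ξ|⁻¹)..(v - |ξ|⁻¹), (w x : ℂ) ^ b * f x * e (-(x * ξ))‖ ≤
        K * (1 + ‖b‖) ^ k * (|ξ|⁻¹ ^ (c + 1) + |ξ|⁻¹ ^ (k - 1 / 2 : ℝ)) := by
  induction k with
  | zero =>
    intro c f hf
    obtain ⟨K, hK, h⟩ := hw.truncated_bound_zero hf c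
    refine ⟨K, hK, fun b hb ξ hξ hξ2 => ?_⟩
    have := h b hb ξ |ξ|⁻¹ (by positivity) hξ2
    simpa using this
  | succ k ih =>
    intro c f hf
    obtain ⟨K₁, hK₁, h₁⟩ := ih (c - 1) _ (hf.mul_deriv hw.smooth)
    obtain ⟨K₂, hK₂, h₂⟩ := ih c _ (hf.derivWithin hw.lt)
    obtain ⟨K₃, hK₃, h₃⟩ := hw.exists_norm_le hf c
    refine ⟨2 ^ k * K₁ + K₂ + 2 * K₃, by positivity, fun b hb ξ hξ hξ2 => ?_⟩
    set δ := |ξ|⁻¹ with hδ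
    have hξ0 : 0 < |ξ| := by linarith
    have hδ0 : 0 < δ := by positivity
    have hδ1 : δ ≤ 1 := inv_le_one_of_one_le₀ hξ
    set J := ∫ x in (u + δ)..(v - δ), (w x : ℂ) ^ b * f x * e (-(x * ξ)) with hJ
    have hibp := hw.integral_by_parts hf b ξ hδ0 hξ2
    have H₁ := h₁ (b - 1) (by simp [hb]) ξ hξ hξ2
    have H₂ := h₂ b hb ξ hξ hξ2
    have H₃ := h₃ b hb ξ (v - δ) ⟨by linarith, by linarith⟩
    have H₄ := h₃ b hb ξ (u + δ) ⟨by linarith, by linarith⟩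
    rw [show min (v - δ - u) (v - (v - δ)) = δ by
      rw [sub_sub_cancel]; exact min_eq_right (by linarith)] at H₃
    rw [show min (u + δ - u) (v - (u + δ)) = δ by
      rw [add_sub_cancel_left]; exact min_eq_left (by linarith)] at H₄
    rw [sub_add_cancel] at H₁
    set β := 1 + ‖b‖ with hβ
    have hβ1 : 1 ≤ β := by rw [hβ]; linarith [norm_nonneg b]
    have hβk : 1 ≤ β ^ (k + 1) := one_le_pow₀ hβ1
    -- Source of the `2 ^ k` in the constant: replacing `b` by `b - 1` at most doubles `1 + ‖b‖`.
    have hβ' : (1 + ‖b - 1‖) ^ k ≤ 2 ^ k * β ^ k := by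
      rw [← mul_pow]
      gcongr
      have := norm_sub_le b 1
      rw [norm_one] at this
      linarith [norm_nonneg b]
    have hpc : 0 < δ ^ c := by positivity
    have hpc1 : δ * δ ^ c = δ ^ (c + 1) := by rw [Real.rpow_add_one hδ0.ne', mul_comm]
    have hpk : 0 < δ ^ ((k : ℝ) - 1 / 2) := by positivity
    have hpk1 : δ * δ ^ ((k : ℝ) - 1 / 2) = δ ^ (((k + 1 : ℕ) : ℝ) - 1 / 2) := by
      rw [mul_comm, ← Real.rpow_add_one hδ0.ne']
      congr 1
      push_cast
      ring
    have hcle : δ ^ (c + 1) ≤ δ ^ c := by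
      rw [← hpc1]; exact mul_le_of_le_one_left hpc.le hδ1
    set Q := δ ^ c + δ ^ ((k : ℝ) - 1 / 2) with hQ
    have hn : |ξ| * ‖J‖ ≤ (2 ^ k * K₁ + K₂ + 2 * K₃) * β ^ (k + 1) * Q := by
      have h2pi : |ξ| * ‖J‖ ≤ ‖2 * Real.pi * Complex.I * ξ * J‖ := by
        simp only [norm_mul, Complex.norm_I, Complex.norm_real, Real.norm_eq_abs, mul_one,
          Complex.norm_ofNat, abs_of_pos Real.pi_pos]
        have : 1 ≤ 2 * Real.pi := by linarith [Real.pi_gt_three]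
        rw [mul_assoc (2 * Real.pi)]
        exact le_mul_of_one_le_left (by positivity) this
      refine h2pi.trans ?_
      rw [hibp]
      refine (norm_sub_le _ _).trans ?_
      refine (add_le_add (norm_add_le _ _) (norm_sub_le _ _)).trans ?_
      rw [norm_mul]
      have t1 : ‖b‖ * ‖∫ x in (u + δ)..(v - δ),
          (w x : ℂ) ^ (b - 1) * (((deriv w x : ℝ) : ℂ) * f x) * e (-(x * ξ))‖ ≤
          2 ^ k * K₁ * β ^ (k + 1) * Q := by
        calc _ ≤ β * (K₁ * (2 ^ k * β ^ k) * Q) := by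
              gcongr
              · rw [hβ]; linarith
              · exact H₁.trans (by gcongr)
          _ = _ := by ring
      have t2 : ‖∫ x in (u + δ)..(v - δ),
          (w x : ℂ) ^ b * derivWithin f (Set.Icc u v) x * e (-(x * ξ))‖ ≤
          K₂ * β ^ (k + 1) * Q := by
        refine H₂.trans (mul_le_mul (mul_le_mul_of_nonneg_left ?_ hK₂) ?_ (by positivity)
          (by positivity))
        · exact pow_le_pow_right₀ hβ1 (Nat.le_succ k)
        · rw [hQ]; linarith
      have t3 : K₃ * δ ^ c ≤ K₃ * β ^ (k + 1) * Q := by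
        rw [mul_assoc]
        gcongr
        calc δ ^ c ≤ Q := by rw [hQ]; linarith
          _ ≤ β ^ (k + 1) * Q := le_mul_of_one_le_left (by positivity) hβk
      linarith
    have hfinal : ‖J‖ = δ * (|ξ| * ‖J‖) := by
      rw [← mul_assoc, hδ, inv_mul_cancel₀ hξ0.ne', one_mul]
    rw [hfinal]
    calc δ * (|ξ| * ‖J‖) ≤ δ * ((2 ^ k * K₁ + K₂ + 2 * K₃) * β ^ (k + 1) * Q) := by gcongr
      _ = (2 ^ k * K₁ + K₂ + 2 * K₃) * β ^ (k + 1) *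
          (δ * δ ^ c + δ * δ ^ ((k : ℝ) - 1 / 2)) := by rw [hQ]; ring
      _ = _ := by rw [hpc1, hpk1]

end Edge

/-! ### Fourier decay over the whole interval. -/

section EdgeBound

variable {u v R c₁ c₂ : ℝ} {w : ℝ → ℝ}

theorem integral_sub_left_rpow {c : ℝ} (hc : -1 < c) (u δ : ℝ) :
    ∫ x in u..(u + δ), (x - u) ^ c = δ ^ (c + 1) / (c + 1) := by
  rw [intervalIntegral.integral_comp_sub_right (fun t => t ^ c) u, sub_self, add_sub_cancel_left,
    integral_rpow (Or.inl hc), Real.zero_rpow (by linarith), sub_zero]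

theorem integral_sub_right_rpow {c : ℝ} (hc : -1 < c) (v δ : ℝ) :
    ∫ x in (v - δ)..v, (v - x) ^ c = δ ^ (c + 1) / (c + 1) := by
  rw [intervalIntegral.integral_comp_sub_left (fun t => t ^ c) v, sub_self, sub_sub_cancel,
    integral_rpow (Or.inl hc), Real.zero_rpow (by linarith), sub_zero]

theorem IsEdgeWeight.integral_bound (hw : IsEdgeWeight u v R c₁ c₂ w) {f : ℝ → ℂ}
    (hf : EdgeTest u v R f) {c : ℝ} (hc : -1 < c) :
    ∃ (K : ℝ) (k : ℕ), 0 ≤ K ∧ ∀ b : ℂ, b.re = c → ∀ ξ : ℝ,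
      IntegrableOn (fun x => (w x : ℂ) ^ b * f x * e (-(x * ξ))) (Set.Ioo u v) ∧
      ‖∫ x in Set.Ioo u v, (w x : ℂ) ^ b * f x * e (-(x * ξ))‖ ≤
        K * (1 + ‖b‖) ^ k * (1 + |ξ|) ^ (-1 - c) := by
  have huv := hw.lt
  -- Enough integrations by parts for `δ ^ (k - 1/2) ≤ δ ^ (c + 1)`.
  obtain ⟨k, hk⟩ := exists_nat_ge (c + 2)
  obtain ⟨K₀, hK₀, h₀⟩ := hw.exists_norm_le hf c
  obtain ⟨K₁, hK₁, h₁⟩ := hw.truncated_bound k c f hf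
  have hI₁ : ∀ a b : ℝ, IntervalIntegrable (fun x : ℝ => (x - u) ^ c) volume a b := fun a b => by
    have := (intervalIntegral.intervalIntegrable_rpow'
      (a := a - u) (b := b - u) hc).comp_sub_right u
    simpa using this
  have hI₂ : ∀ a b : ℝ, IntervalIntegrable (fun x : ℝ => (v - x) ^ c) volume a b := fun a b => by
    have := (intervalIntegral.intervalIntegrable_rpow'
      (a := v - a) (b := v - b) hc).comp_sub_left v
    simpa using this
  set g : ℝ → ℝ := fun x => K₀ * ((x - u) ^ c + (v - x) ^ c) with hg
  have hgI : IntervalIntegrable g volume u v := ((hI₁ u v).add (hI₂ u v)).const_mul _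
  have hgI' : IntegrableOn g (Set.Ioo u v) := by
    rw [← integrableOn_Ioc_iff_integrableOn_Ioo]
    exact (intervalIntegrable_iff_integrableOn_Ioc_of_le huv.le).1 hgI
  set V : ℝ := ∫ x in Set.Ioo u v, g x with hV
  have hV0 : 0 ≤ V := setIntegral_nonneg measurableSet_Ioo fun x hx => by
    have : 0 < x - u := by linarith [hx.1]
    have : 0 < v - x := by linarith [hx.2]
    positivity
  -- For `|ξ| > Ξ` both `|ξ| ≥ 1` and `|ξ|⁻¹ < (v - u) / 2` hold; below it the absolute bound `V` is
  -- enough.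
  set Ξ : ℝ := 1 + 2 / (v - u) with hΞ
  have hvu : 0 < v - u := by linarith
  have hΞ0 : 0 < Ξ := by positivity
  have hc1 : 0 < c + 1 := by linarith
  refine ⟨(K₁ * 2 + 2 * (K₀ / (c + 1))) * 2 ^ (c + 1) + V * (1 + Ξ) ^ (c + 1), k, by positivity,
    fun b hb ξ => ?_⟩
  set F : ℝ → ℂ := fun x => (w x : ℂ) ^ b * f x * e (-(x * ξ)) with hF
  have hbound : ∀ x ∈ Set.Ioo u v, ‖F x‖ ≤ g x := fun x hx => by
    refine (h₀ b hb ξ x hx).trans ?_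
    rw [hg]
    have := min_rpow_le (show 0 < x - u by linarith [hx.1]) (show 0 < v - x by linarith [hx.2]) c
    exact mul_le_mul_of_nonneg_left this hK₀
  have hbound' : ∀ᵐ x ∂(volume.restrict (Set.Ioo u v)), ‖F x‖ ≤ g x :=
    (ae_restrict_iff' measurableSet_Ioo).2 (Eventually.of_forall hbound)
  have hFI : IntegrableOn F (Set.Ioo u v) :=
    hgI'.mono' ((hw.continuousOn hf b ξ).aestronglyMeasurable measurableSet_Ioo) hbound'
  refine ⟨hFI, ?_⟩
  have hβ : 1 ≤ (1 + ‖b‖) ^ k := one_le_pow₀ (by linarith [norm_nonneg b])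
  have hξ0 := abs_nonneg ξ
  have hξ1 : 0 < 1 + |ξ| := by linarith
  have hpow : (1 + |ξ|) ^ (c + 1) * (1 + |ξ|) ^ (-1 - c) = 1 := by
    rw [← Real.rpow_add hξ1, show c + 1 + (-1 - c) = 0 by ring, Real.rpow_zero]
  have hpos : 0 < (1 + |ξ|) ^ (-1 - c) := Real.rpow_pos_of_pos hξ1 _
  rcases lt_or_ge Ξ |ξ| with hbig | hsmall
  · have h2vu : 0 < 2 / (v - u) := by positivity
    have h1ξ : 1 ≤ |ξ| := by linarith
    have hξpos : 0 < |ξ| := by linarith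
    set δ : ℝ := |ξ|⁻¹ with hδ
    have hδ0 : 0 < δ := by positivity
    have hδ1 : δ ≤ 1 := inv_le_one_of_one_le₀ h1ξ
    have hδ2 : δ < (v - u) / 2 := by
      rw [hδ, inv_lt_comm₀ hξpos (by positivity), inv_div]
      linarith
    have hFint : IntervalIntegrable F volume u v := by
      rw [intervalIntegrable_iff_integrableOn_Ioc_of_le huv.le,
        integrableOn_Ioc_iff_integrableOn_Ioo]
      exact hFI
    have hsub : ∀ a b : ℝ, u ≤ a → a ≤ b → b ≤ v → IntervalIntegrable F volume a b :=
      fun a b h1 h2 h3 => hFint.mono_set (by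
        rw [Set.uIcc_of_le h2, Set.uIcc_of_le huv.le]
        exact Set.Icc_subset_Icc h1 h3)
    have hi1 := hsub u (u + δ) le_rfl (by linarith) (by linarith)
    have hi2 := hsub (u + δ) (v - δ) (by linarith) (by linarith) (by linarith)
    have hi3 := hsub (v - δ) v (by linarith) (by linarith) le_rfl
    have hsplit : ∫ x in Set.Ioo u v, F x = (∫ x in u..(u + δ), F x) +
        (∫ x in (u + δ)..(v - δ), F x) + ∫ x in (v - δ)..v, F x := by
      rw [intervalIntegral.integral_add_adjacent_intervals hi1 hi2,
        intervalIntegral.integral_add_adjacent_intervals (hi1.trans hi2) hi3,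
        intervalIntegral.integral_of_le huv.le, integral_Ioc_eq_integral_Ioo]
    have e1 : ‖∫ x in u..(u + δ), F x‖ ≤ K₀ / (c + 1) * δ ^ (c + 1) := by
      refine (intervalIntegral.norm_integral_le_of_norm_le (g := fun x => K₀ * (x - u) ^ c)
        (by linarith) (Eventually.of_forall fun x hx => ?_) ((hI₁ _ _).const_mul _)).trans ?_
      · have := h₀ b hb ξ x ⟨hx.1, by linarith [hx.2]⟩
        rwa [min_eq_left (by linarith [hx.2])] at this
      · rw [intervalIntegral.integral_const_mul, integral_sub_left_rpow hc]
        exact le_of_eq (by ring)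
    have e3 : ‖∫ x in (v - δ)..v, F x‖ ≤ K₀ / (c + 1) * δ ^ (c + 1) := by
      refine (intervalIntegral.norm_integral_le_of_norm_le (g := fun x => K₀ * (v - x) ^ c)
        (by linarith) ?_ ((hI₂ _ _).const_mul _)).trans ?_
      -- The half-open interval contains `v`, where the pointwise bound is not available; a null set
      -- is discarded.
      · filter_upwards [(Set.countable_singleton v).ae_notMem volume] with x hxv hx
        have hxv' : x < v := lt_of_le_of_ne hx.2 hxv
        have := h₀ b hb ξ x ⟨by linarith [hx.1], hxv'⟩
        rwa [min_eq_right (by linarith [hx.1])] at this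
      · rw [intervalIntegral.integral_const_mul, integral_sub_right_rpow hc]
        exact le_of_eq (by ring)
    have e2 := h₁ b hb ξ h1ξ hδ2
    have hδk : δ ^ ((k : ℝ) - 1 / 2) ≤ δ ^ (c + 1) :=
      Real.rpow_le_rpow_of_exponent_ge hδ0 hδ1 (by linarith)
    have hδξ : δ ^ (c + 1) ≤ 2 ^ (c + 1) * (1 + |ξ|) ^ (-1 - c) := by
      have h1 : δ ≤ 2 * (1 + |ξ|)⁻¹ := by
        rw [hδ, ← div_eq_mul_inv, le_div_iff₀ hξ1, inv_mul_le_iff₀ hξpos]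
        linarith
      calc δ ^ (c + 1) ≤ (2 * (1 + |ξ|)⁻¹) ^ (c + 1) := Real.rpow_le_rpow hδ0.le h1 hc1.le
        _ = _ := by
          rw [Real.mul_rpow (by norm_num) (by positivity), Real.inv_rpow hξ1.le,
            ← Real.rpow_neg hξ1.le, show -(c + 1) = -1 - c by ring]
    have hδc : 0 < δ ^ (c + 1) := by positivity
    rw [hsplit]
    calc _ ≤ ‖∫ x in u..(u + δ), F x‖ + ‖∫ x in (u + δ)..(v - δ), F x‖ +
          ‖∫ x in (v - δ)..v, F x‖ := norm_add₃_le
      _ ≤ K₀ / (c + 1) * δ ^ (c + 1) +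
          K₁ * (1 + ‖b‖) ^ k * (δ ^ (c + 1) + δ ^ (c + 1)) + K₀ / (c + 1) * δ ^ (c + 1) := by
          refine add_le_add (add_le_add e1 (e2.trans ?_)) e3
          gcongr
      _ = 2 * (K₀ / (c + 1)) * δ ^ (c + 1) * 1 + K₁ * 2 * (1 + ‖b‖) ^ k * δ ^ (c + 1) := by ring
      _ ≤ 2 * (K₀ / (c + 1)) * δ ^ (c + 1) * (1 + ‖b‖) ^ k +
          K₁ * 2 * (1 + ‖b‖) ^ k * δ ^ (c + 1) := by gcongr
      _ = (K₁ * 2 + 2 * (K₀ / (c + 1))) * (1 + ‖b‖) ^ k * δ ^ (c + 1) := by ring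
      _ ≤ (K₁ * 2 + 2 * (K₀ / (c + 1))) * (1 + ‖b‖) ^ k *
          (2 ^ (c + 1) * (1 + |ξ|) ^ (-1 - c)) := by gcongr
      _ = (K₁ * 2 + 2 * (K₀ / (c + 1))) * 2 ^ (c + 1) * (1 + ‖b‖) ^ k *
          (1 + |ξ|) ^ (-1 - c) := by ring
      _ ≤ _ := by
          gcongr
          have : 0 ≤ V * (1 + Ξ) ^ (c + 1) := by positivity
          linarith
  · have h1 : ‖∫ x in Set.Ioo u v, F x‖ ≤ V := norm_integral_le_of_norm_le hgI' hbound'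
    have h2 : (1 + |ξ|) ^ (c + 1) ≤ (1 + Ξ) ^ (c + 1) :=
      Real.rpow_le_rpow hξ1.le (by linarith) hc1.le
    calc _ ≤ V := h1
      _ = V * ((1 + |ξ|) ^ (c + 1) * (1 + |ξ|) ^ (-1 - c)) := by rw [hpow, mul_one]
      _ ≤ V * ((1 + Ξ) ^ (c + 1) * (1 + |ξ|) ^ (-1 - c)) := by gcongr
      _ = V * (1 + Ξ) ^ (c + 1) * 1 * (1 + |ξ|) ^ (-1 - c) := by ring
      _ ≤ V * (1 + Ξ) ^ (c + 1) * (1 + ‖b‖) ^ k * (1 + |ξ|) ^ (-1 - c) := by gcongr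
      _ ≤ _ := by
          gcongr
          have : 0 ≤ (K₁ * 2 + 2 * (K₀ / (c + 1))) * 2 ^ (c + 1) := by positivity
          linarith

end EdgeBound

/-! ### The local integral at the real place -/

theorem measurableSet_X (sgn : ℤˣ) (ι : Fin 2) : MeasurableSet (X sgn ι) := by
  unfold X
  split_ifs
  · exact measurableSet_lt measurable_const (by fun_prop)
  · exact measurableSet_lt (by fun_prop) measurable_const

/-- The bound for the local integral at the real place over the set `S`. -/
def ArchBound (sgn : ℤˣ) (c : ℝ) (f : ℝ → ℂ) (S : Set ℝ) : Prop :=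
  ∃ (K : ℝ) (k : ℕ), 0 ≤ K ∧ ∀ b : ℂ, b.re = c → ∀ ξ : ℝ,
    IntegrableOn (fun x => (archNorm sgn x : ℂ) ^ b * f x * e (-(x * ξ))) S ∧
    ‖∫ x in S, (archNorm sgn x : ℂ) ^ b * f x * e (-(x * ξ))‖ ≤
      K * (1 + ‖b‖) ^ k * (1 + |ξ|) ^ (-1 - c)

theorem ArchBound.empty (sgn : ℤˣ) (c : ℝ) (f : ℝ → ℂ) : ArchBound sgn c f ∅ :=
  ⟨0, 0, le_rfl, fun b _ ξ => ⟨integrableOn_empty, by simp⟩⟩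

theorem IsEdgeWeight.archBound {u v R c₁ c₂ c : ℝ} {w : ℝ → ℝ} {f : ℝ → ℂ} {sgn : ℤˣ}
    (hw : IsEdgeWeight u v R c₁ c₂ w) (hf : EdgeTest u v R f) (hc : -1 < c)
    (heq : ∀ x ∈ Set.Ioo u v, archNorm sgn x = w x) : ArchBound sgn c f (Set.Ioo u v) := by
  obtain ⟨K, k, hK, h⟩ := hw.integral_bound hf hc
  refine ⟨K, k, hK, fun b hb ξ => ?_⟩
  have hcongr : Set.EqOn (fun x => (w x : ℂ) ^ b * f x * e (-(x * ξ)))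
      (fun x => (archNorm sgn x : ℂ) ^ b * f x * e (-(x * ξ))) (Set.Ioo u v) := fun x hx => by
    simp only [heq x hx]
  obtain ⟨h1, h2⟩ := h b hb ξ
  refine ⟨h1.congr_fun hcongr measurableSet_Ioo, ?_⟩
  rwa [setIntegral_congr_fun measurableSet_Ioo hcongr] at h2

theorem ArchBound.union {sgn : ℤˣ} {c : ℝ} {f : ℝ → ℂ} {S T : Set ℝ} (hS : ArchBound sgn c f S)
    (hT : ArchBound sgn c f T) (hd : Disjoint S T) (hTm : MeasurableSet T) :
    ArchBound sgn c f (S ∪ T) := by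
  obtain ⟨K, k, hK, h⟩ := hS
  obtain ⟨K', k', hK', h'⟩ := hT
  refine ⟨K + K', max k k', by positivity, fun b hb ξ => ?_⟩
  obtain ⟨h1, h2⟩ := h b hb ξ
  obtain ⟨h1', h2'⟩ := h' b hb ξ
  refine ⟨h1.union h1', ?_⟩
  rw [setIntegral_union hd hTm h1 h1']
  have hβ : 1 ≤ 1 + ‖b‖ := by linarith [norm_nonneg b]
  have hξ : 0 < (1 + |ξ|) ^ (-1 - c) := Real.rpow_pos_of_pos (by linarith [abs_nonneg ξ]) _
  calc _ ≤ _ := norm_add_le _ _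
    _ ≤ K * (1 + ‖b‖) ^ k * (1 + |ξ|) ^ (-1 - c) +
        K' * (1 + ‖b‖) ^ k' * (1 + |ξ|) ^ (-1 - c) := add_le_add h2 h2'
    _ ≤ K * (1 + ‖b‖) ^ max k k' * (1 + |ξ|) ^ (-1 - c) +
        K' * (1 + ‖b‖) ^ max k k' * (1 + |ξ|) ^ (-1 - c) := by
      gcongr
      · exact le_max_left _ _
      · exact le_max_right _ _
    _ = _ := by ring

theorem ArchBound.of_subset {sgn : ℤˣ} {c : ℝ} {f : ℝ → ℂ} {S T : Set ℝ}
    (hS : ArchBound sgn c f S) (hST : S ⊆ T) (hT : MeasurableSet T)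
    (h0 : ∀ x ∈ T \ S, f x = 0) : ArchBound sgn c f T := by
  obtain ⟨K, k, hK, h⟩ := hS
  refine ⟨K, k, hK, fun b hb ξ => ?_⟩
  obtain ⟨h1, h2⟩ := h b hb ξ
  have h0' : ∀ x ∈ T \ S, (archNorm sgn x : ℂ) ^ b * f x * e (-(x * ξ)) = 0 := fun x hx => by
    rw [h0 x hx, mul_zero, zero_mul]
  refine ⟨h1.of_forall_sdiff_eq_zero hT h0', ?_⟩
  rwa [setIntegral_eq_of_subset_of_forall_sdiff_eq_zero hT hST h0']

/-- Only the end point `1` is a zero of the weight. The end point `R + 1` is artificial: on `[-R,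
R]` its distance is at least `1`, so it does not spoil the comparison. -/
theorem isEdgeWeight_right {R : ℝ} (hR : 1 ≤ R) :
    IsEdgeWeight 1 (R + 1) R 1 ((R + 1) * R) (fun x => x ^ 2 - 1) where
  lt := by linarith
  pos₁ := one_pos
  pos₂ := by positivity
  smooth := by fun_prop
  pos := fun x hx => by nlinarith [hx.1]
  ge := fun x hx _ => by
    have h1 := min_le_left (x - 1) (R + 1 - x)
    nlinarith [hx.1]
  le := fun x hx hxR => by
    have hx1 := hx.1
    have hxR' := (abs_le.1 hxR).2
    have h1 : x - 1 ≤ R * min (x - 1) (R + 1 - x) := by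
      rcases min_choice (x - 1) (R + 1 - x) with h | h <;> rw [h] <;> nlinarith
    calc x ^ 2 - 1 = (x + 1) * (x - 1) := by ring
      _ ≤ (R + 1) * (R * min (x - 1) (R + 1 - x)) :=
        mul_le_mul (by linarith) h1 (by linarith) (by linarith)
      _ = _ := by ring

theorem isEdgeWeight_left {R : ℝ} (hR : 1 ≤ R) :
    IsEdgeWeight (-(R + 1)) (-1) R 1 ((R + 1) * R) (fun x => x ^ 2 - 1) where
  lt := by linarith
  pos₁ := one_pos
  pos₂ := by positivity
  smooth := by fun_prop
  pos := fun x hx => by nlinarith [hx.2]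
  ge := fun x hx hxR => by
    have h := (isEdgeWeight_right hR).ge (-x) ⟨by linarith [hx.2], by linarith [hx.1]⟩
      (by rwa [abs_neg])
    rw [min_comm]
    convert h using 1
    · congr 2 <;> ring
    · ring
  le := fun x hx hxR => by
    have h := (isEdgeWeight_right hR).le (-x) ⟨by linarith [hx.2], by linarith [hx.1]⟩
      (by rwa [abs_neg])
    rw [min_comm]
    convert h using 1
    · ring
    · congr 2 <;> ring

theorem isEdgeWeight_middle {R : ℝ} : IsEdgeWeight (-1) 1 R 1 2 (fun x => 1 - x ^ 2) where
  lt := by norm_num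
  pos₁ := one_pos
  pos₂ := two_pos
  smooth := by fun_prop
  pos := fun x hx => by nlinarith [hx.1, hx.2]
  ge := fun x hx _ => by
    have h1 := hx.1
    have h2 := hx.2
    rcases le_total (x - -1) (1 - x) with h | h
    · rw [min_eq_left h]; nlinarith
    · rw [min_eq_right h]; nlinarith
  le := fun x hx _ => by
    have h1 := hx.1
    have h2 := hx.2
    rcases le_total (x - -1) (1 - x) with h | h
    · rw [min_eq_left h]; nlinarith
    · rw [min_eq_right h]; nlinarith

/-- The weight has no zeros and both end points are artificial; on `[-R, R]` weight and distance are
bounded above and away from zero. -/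
theorem isEdgeWeight_line {R : ℝ} (hR : 1 ≤ R) :
    IsEdgeWeight (-(R + 1)) (R + 1) R (2 * R + 1)⁻¹ (R ^ 2 + 1) (fun x => x ^ 2 + 1) where
  lt := by linarith
  pos₁ := by positivity
  pos₂ := by positivity
  smooth := by fun_prop
  pos := fun x _ => by positivity
  ge := fun x hx hxR => by
    have hx1 := (abs_le.1 hxR).1
    rw [inv_mul_le_iff₀ (by linarith)]
    have h1 := min_le_right (x - -(R + 1)) (R + 1 - x)
    nlinarith [sq_nonneg x]
  le := fun x hx hxR => by
    obtain ⟨hx1, hx2⟩ := abs_le.1 hxR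
    have h1 : 1 ≤ min (x - -(R + 1)) (R + 1 - x) := le_min (by linarith) (by linarith)
    have h2 : x ^ 2 ≤ R ^ 2 := sq_le_sq' hx1 hx2
    calc x ^ 2 + 1 ≤ (R ^ 2 + 1) * 1 := by linarith
      _ ≤ _ := by gcongr

theorem edgeTest_of_subset {S : Set ℝ} {f : ℝ → ℂ} {u v R : ℝ} (huv : u < v)
    (hf : ContDiffOn ℝ ∞ f (closure S)) (hR : ∀ x ∈ S, R < |x| → f x = 0)
    (hsub : Set.Ioo u v ⊆ S) : EdgeTest u v R f := by
  refine ⟨hf.mono ?_, fun x hx => hR x (hsub hx)⟩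
  rw [← closure_Ioo huv.ne]
  exact closure_mono hsub

/-- According to the sign and `ι`, the domain is two half-lines, `(-1, 1)`, the whole line or empty.
Unbounded components are cut at `±(R + 1)`, beyond the region where `f` can be nonzero. -/
theorem arch_local_bound (sgn : ℤˣ) (ι : Fin 2) {c : ℝ} (hc : -1 < c) {f : ℝ → ℂ}
    (hf : SmoothUpToBoundary (X sgn ι) f) : ArchBound sgn c f (X sgn ι) := by
  obtain ⟨hf1, R₀, hR₀⟩ := hf
  have hXm := measurableSet_X sgn ι
  set R := max 1 R₀ with hRdef
  have hR : 1 ≤ R := le_max_left _ _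
  have hf2 : ∀ x ∈ X sgn ι, R < |x| → f x = 0 := fun x hx h =>
    hR₀ x hx ((le_max_right _ _).trans_lt h)
  rcases Int.units_eq_one_or sgn with rfl | rfl
  · by_cases hι : ι = 0
    · have hX : X 1 ι = {x | 0 < x ^ 2 - 1} := by simp [X, hι]
      rw [hX] at hf1 hf2 hXm ⊢
      have hs1 : Set.Ioo 1 (R + 1) ⊆ {x : ℝ | 0 < x ^ 2 - 1} := fun x hx =>
        (isEdgeWeight_right hR).pos x hx
      have hs2 : Set.Ioo (-(R + 1)) (-1) ⊆ {x : ℝ | 0 < x ^ 2 - 1} := fun x hx =>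
        (isEdgeWeight_left hR).pos x hx
      have b1 := (isEdgeWeight_right hR).archBound (sgn := 1)
        (edgeTest_of_subset (isEdgeWeight_right hR).lt hf1 hf2 hs1) hc (fun x hx => by
          rw [archNorm]; simpa using (isEdgeWeight_right hR).pos x hx |>.le)
      have b2 := (isEdgeWeight_left hR).archBound (sgn := 1)
        (edgeTest_of_subset (isEdgeWeight_left hR).lt hf1 hf2 hs2) hc (fun x hx => by
          rw [archNorm]; simpa using (isEdgeWeight_left hR).pos x hx |>.le)
      refine (b1.union b2 ?_ measurableSet_Ioo).of_subset (Set.union_subset hs1 hs2) hXm ?_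
      · exact Set.disjoint_left.2 fun x h1 h2 => by linarith [h1.1, h2.2]
      · rintro x ⟨hx1, hx2⟩
        refine hf2 x hx1 ?_
        by_contra! hxR
        obtain ⟨h1, h2⟩ := abs_le.1 hxR
        have hx1' : 0 < x ^ 2 - 1 := hx1
        refine hx2 ?_
        rcases le_or_gt x 0 with h0 | h0
        · exact Or.inr ⟨by linarith, by nlinarith⟩
        · exact Or.inl ⟨by nlinarith, by linarith⟩
    · have hX : X 1 ι = {x | x ^ 2 - 1 < 0} := by simp [X, hι]
      have hX' : X 1 ι = Set.Ioo (-1) 1 := by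
        rw [hX]
        ext x
        simp only [Set.mem_ofPred_eq, Set.mem_Ioo, ← abs_lt, ← sq_lt_one_iff_abs_lt_one]
        constructor <;> intro h <;> linarith
      rw [hX'] at hf1 hf2 ⊢
      exact isEdgeWeight_middle.archBound
        (edgeTest_of_subset (R := R) (by norm_num) hf1 hf2 subset_rfl) hc (fun x hx => by
          have h := (isEdgeWeight_middle (R := R)).pos x hx
          rw [archNorm, abs_of_neg] <;> push_cast <;> linarith)
  · by_cases hι : ι = 0
    · have hX : X (-1) ι = Set.univ := by
        ext x
        simp only [X, hι, if_true, Set.mem_ofPred_eq, Set.mem_univ, iff_true]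
        push_cast
        nlinarith [sq_nonneg x]
      rw [hX] at hf1 hf2 hXm ⊢
      have b1 := (isEdgeWeight_line hR).archBound (sgn := -1)
        (edgeTest_of_subset (isEdgeWeight_line hR).lt hf1 hf2 (Set.subset_univ _)) hc
        (fun x hx => by
          have h := (isEdgeWeight_line hR).pos x hx
          rw [archNorm, abs_of_pos] <;> push_cast <;> linarith)
      refine b1.of_subset (Set.subset_univ _) hXm ?_
      rintro x ⟨hx1, hx2⟩
      refine hf2 x hx1 ?_
      by_contra! hxR
      obtain ⟨h1, h2⟩ := abs_le.1 hxR
      exact hx2 ⟨by linarith, by linarith⟩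
    · have hX : X (-1) ι = ∅ := by
        ext x
        simp only [X, hι, if_false, Set.mem_ofPred_eq, Set.mem_empty_iff_false, iff_false]
        push_cast
        nlinarith [sq_nonneg x]
      rw [hX]
      exact ArchBound.empty _ _ _

/-! ### The semilocal integral -/

section Assembly

variable {r : ℕ} (q : Fin r → ℕ) [∀ i, Fact (q i).Prime]

/-- The source of uniformity in `n`: at `q i`, both `n` and the other primes are units. -/
theorem norm_four_mul_bigN (hq : Function.Injective q) (sgn : ℤˣ) (ν : Fin r → ℤ) {n : ℕ}
    (hn : ∀ i, Nat.Coprime n (q i)) (i : Fin r) :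
    ‖4 * (bigN q sgn ν n : ℚ_[q i])‖ = ‖(4 : ℚ_[q i])‖ * (q i : ℝ) ^ (-ν i) := by
  rw [norm_mul]
  congr 1
  have hs : ‖(((sgn : ℤ) : ℚ) : ℚ_[q i])‖ = 1 := by
    rcases Int.units_eq_one_or sgn with rfl | rfl <;> simp
  have hn' : ‖((n : ℚ) : ℚ_[q i])‖ = 1 := by
    rw [Rat.cast_natCast, Padic.norm_natCast_eq_one_iff]
    exact (hn i).symm
  rw [bigN, Rat.cast_mul, Rat.cast_mul, norm_mul, norm_mul, hs, hn', one_mul, one_mul,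
    Rat.cast_prod, norm_prod, Finset.prod_eq_single i]
  · rw [Rat.cast_zpow, Rat.cast_natCast, Padic.norm_p_zpow]
  · intro j _ hj
    rw [Rat.cast_zpow, Rat.cast_natCast, norm_zpow]
    have : ‖((q j : ℕ) : ℚ_[q i])‖ = 1 := by
      rw [Padic.norm_natCast_eq_one_iff, Nat.coprime_primes Fact.out Fact.out]
      exact fun h => hj (hq h).symm
    rw [this, one_zpow]
  · simp

theorem cpow_eq_exp {x : ℝ} (hx : 0 < x) (s : ℂ) :
    (x : ℂ) ^ s = Complex.exp (s * (Real.log x : ℝ)) := by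
  rw [Complex.cpow_def_of_ne_zero (by exact_mod_cast hx.ne'), Complex.ofReal_log hx.le, mul_comm]

/-- This identity separates the places. -/
theorem cpow_neg_div_sqrt {C w : ℝ} {m : Fin r → ℝ} (hC : 0 < C) (hw : 0 < w) (hm : ∀ i, 0 < m i)
    (s : ℂ) :
    ((C / (w ^ (1 / 2 : ℝ) * (∏ i, m i) ^ (1 / 2 : ℝ)) : ℝ) : ℂ) ^ (-s) =
      (C : ℂ) ^ (-s) * ((w : ℂ) ^ (s / 2) * ∏ i, (m i : ℂ) ^ (s / 2)) := by
  have hP : 0 < ∏ i, m i := Finset.prod_pos fun i _ => hm i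
  have hlog : Real.log (C / (w ^ (1 / 2 : ℝ) * (∏ i, m i) ^ (1 / 2 : ℝ))) =
      Real.log C - (1 / 2 * Real.log w + 1 / 2 * ∑ i, Real.log (m i)) := by
    rw [Real.log_div hC.ne' (by positivity), Real.log_mul (by positivity) (by positivity),
      Real.log_rpow hw, Real.log_rpow hP, Real.log_prod fun i _ => (hm i).ne']
  rw [cpow_eq_exp (by positivity), hlog, cpow_eq_exp hC, cpow_eq_exp hw]
  simp only [cpow_eq_exp (hm _)]
  rw [← Complex.exp_sum, ← Complex.exp_add, ← Complex.exp_add, ← Finset.mul_sum]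
  congr 1
  push_cast
  ring

theorem restrict_domain (sgn : ℤˣ) (N : ℚ) (ι : Fin 2) (ε : Fin r → ℤ) :
    (semilocalMeasure q).restrict (domain q sgn N ι ε) =
      ((volume : Measure ℝ).restrict (X sgn ι)).prod
        (Measure.pi fun i => (padicHaar (q i)).restrict (Y (q i) N (ε i))) := by
  rw [semilocalMeasure, domain, ← Measure.prod_restrict, Measure.restrict_pi_pi]

theorem measurableSet_Y (p : ℕ) [Fact p.Prime] (N : ℚ) (ε : ℤ) : MeasurableSet (Y p N ε) :=
  (isOpen_symbolSet (4 * (N : ℚ_[p])) ε).measurableSet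

theorem measurableSet_domain (sgn : ℤˣ) (N : ℚ) (ι : Fin 2) (ε : Fin r → ℤ) :
    MeasurableSet (domain q sgn N ι ε) :=
  (measurableSet_X sgn ι).prod (MeasurableSet.univ_pi fun i => measurableSet_Y (q i) N (ε i))

theorem archNorm_pos {sgn : ℤˣ} {ι : Fin 2} {x : ℝ} (hx : x ∈ X sgn ι) : 0 < archNorm sgn x := by
  rw [archNorm, abs_pos]
  unfold X at hx
  split_ifs at hx
  · exact ne_of_gt hx
  · exact ne_of_lt hx

/-- The local factor at the real place, with exponent `b`. -/
noncomputable def archFactor (sgn : ℤˣ) (φbar : ℝ → ℂ) (ξ : ℝ) (b : ℂ) (x : ℝ) : ℂ :=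
  (archNorm sgn x : ℂ) ^ b * φbar x * e (-(x * ξ))

/-- The local factor at `p`, with exponent `b`. -/
noncomputable def padicFactor (p : ℕ) [Fact p.Prime] (N : ℚ) (ψbar : ℚ_[p] → ℂ) (η : ℚ_[p])
    (b : ℂ) (y : ℚ_[p]) : ℂ :=
  (modNorm p (y ^ 2 - 4 * (N : ℚ_[p])) : ℂ) ^ b * ψbar y * padicE p (-(y * η))

/-- The integrand without the factor involving `Φ`. -/
noncomputable def baseFactor (sgn : ℤˣ) (N : ℚ) (a₀ : ℂ) (a : Fin r → ℂ) (φbar : ℝ → ℂ)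
    (ψbar : ∀ i, ℚ_[q i] → ℂ) (ξ : ℝ) (η : ∀ i, ℚ_[q i]) (z : ℝ × (∀ i, ℚ_[q i])) : ℂ :=
  archFactor sgn φbar ξ (a₀ / 2) z.1 *
    ∏ i, padicFactor (q i) N (ψbar i) (η i) (a i / 2) (z.2 i)

/-- The argument of `Φ` in the integrand. -/
noncomputable def phiArg (sgn : ℤˣ) (N : ℚ) (C : ℝ) (z : ℝ × (∀ i, ℚ_[q i])) : ℝ :=
  C / (archNorm sgn z.1 ^ (1 / 2 : ℝ) *
    (∏ i, modNorm (q i) (z.2 i ^ 2 - 4 * (N : ℚ_[q i]))) ^ (1 / 2 : ℝ))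

theorem integrand_eq (sgn : ℤˣ) (N : ℚ) (Φ : ℝ → ℂ) (a₀ : ℂ) (a : Fin r → ℂ) (φbar : ℝ → ℂ)
    (ψbar : ∀ i, ℚ_[q i] → ℂ) (C ξ : ℝ) (η : ∀ i, ℚ_[q i]) (z : ℝ × (∀ i, ℚ_[q i])) :
    integrand q sgn N Φ a₀ a φbar ψbar C ξ η z =
      baseFactor q sgn N a₀ a φbar ψbar ξ η z * Φ (phiArg q sgn N C z) := by
  simp only [integrand, baseFactor, phiArg, archFactor, padicFactor, phi, psi,
    Finset.prod_mul_distrib]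
  ring

variable {q} {sgn : ℤˣ} {N : ℚ} {ι : Fin 2} {ε : Fin r → ℤ}

theorem phiArg_pos {C : ℝ} (hC : 0 < C) {z : ℝ × (∀ i, ℚ_[q i])} (hz : z ∈ domain q sgn N ι ε) :
    0 < phiArg q sgn N C z := by
  have h1 := archNorm_pos hz.1
  have h2 : 0 < ∏ i, modNorm (q i) (z.2 i ^ 2 - 4 * (N : ℚ_[q i])) :=
    Finset.prod_pos fun i _ => modNorm_pos (hz.2 i trivial).1
  unfold phiArg
  positivity

theorem baseFactor_mul_cpow {C : ℝ} (hC : 0 < C) {z : ℝ × (∀ i, ℚ_[q i])}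
    (hz : z ∈ domain q sgn N ι ε) (a₀ : ℂ) (a : Fin r → ℂ) (φbar : ℝ → ℂ)
    (ψbar : ∀ i, ℚ_[q i] → ℂ) (ξ : ℝ) (η : ∀ i, ℚ_[q i]) (s : ℂ) :
    baseFactor q sgn N a₀ a φbar ψbar ξ η z * (phiArg q sgn N C z : ℂ) ^ (-s) =
      (C : ℂ) ^ (-s) * (archFactor sgn φbar ξ ((a₀ + s) / 2) z.1 *
        ∏ i, padicFactor (q i) N (ψbar i) (η i) ((a i + s) / 2) (z.2 i)) := by
  have h1 := archNorm_pos hz.1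
  have h2 : ∀ i, 0 < modNorm (q i) (z.2 i ^ 2 - 4 * (N : ℚ_[q i])) := fun i =>
    modNorm_pos (hz.2 i trivial).1
  have h1' : (archNorm sgn z.1 : ℂ) ≠ 0 := by exact_mod_cast h1.ne'
  have h2' : ∀ i, (modNorm (q i) (z.2 i ^ 2 - 4 * (N : ℚ_[q i])) : ℂ) ≠ 0 := fun i => by
    exact_mod_cast (h2 i).ne'
  rw [phiArg, cpow_neg_div_sqrt hC h1 h2]
  simp only [baseFactor, archFactor, padicFactor, add_div, Complex.cpow_add _ _ h1',
    Complex.cpow_add _ _ (h2' _), Finset.prod_mul_distrib]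
  ring

theorem continuousOn_archFactor {φbar : ℝ → ℂ} (hφ : ContinuousOn φbar (closure (X sgn ι)))
    (ξ : ℝ) (b : ℂ) : ContinuousOn (archFactor sgn φbar ξ b) (X sgn ι) := by
  refine ((ContinuousOn.cpow ?_ continuousOn_const ?_).mul (hφ.mono subset_closure)).mul
    (continuous_e_mul ξ).continuousOn
  · unfold archNorm; fun_prop
  · exact fun x hx => Complex.ofReal_mem_slitPlane.2 (archNorm_pos hx)

theorem continuousOn_padicFactor {p : ℕ} [Fact p.Prime] {ψbar : ℚ_[p] → ℂ} (hψ : Continuous ψbar)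
    (η : ℚ_[p]) (b : ℂ) (ε : ℤ) : ContinuousOn (padicFactor p N ψbar η b) (Y p N ε) :=
  ((continuousOn_modNorm_sq_sub_cpow (4 * (N : ℚ_[p])) ε b).mul hψ.continuousOn).mul
    ((continuous_padicE p).comp (by fun_prop)).continuousOn

theorem continuousOn_baseFactor {φbar : ℝ → ℂ} (hφ : ContinuousOn φbar (closure (X sgn ι)))
    {ψbar : ∀ i, ℚ_[q i] → ℂ} (hψ : ∀ i, Continuous (ψbar i)) (a₀ : ℂ) (a : Fin r → ℂ)
    (ξ : ℝ) (η : ∀ i, ℚ_[q i]) :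
    ContinuousOn (baseFactor q sgn N a₀ a φbar ψbar ξ η) (domain q sgn N ι ε) := by
  refine ContinuousOn.mul ?_ (continuousOn_finsetProd _ fun i _ => ?_)
  · exact (continuousOn_archFactor hφ ξ _).comp continuousOn_fst fun z hz => hz.1
  · exact (continuousOn_padicFactor (hψ i) (η i) _ (ε i)).comp
      (f := fun z : ℝ × (∀ i, ℚ_[q i]) => z.2 i) (by fun_prop) fun z hz => hz.2 i trivial

theorem continuousOn_phiArg {C : ℝ} :
    ContinuousOn (phiArg q sgn N C) (domain q sgn N ι ε) := by
  have hpos : ∀ z ∈ domain q sgn N ι ε, 0 < ∏ i, modNorm (q i) (z.2 i ^ 2 - 4 * (N : ℚ_[q i])) :=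
    fun z hz => Finset.prod_pos fun i _ => modNorm_pos (hz.2 i trivial).1
  refine continuousOn_const.div (ContinuousOn.mul ?_ ?_) ?_
  · refine ContinuousOn.rpow_const ?_ fun _ _ => Or.inr (by norm_num)
    unfold archNorm
    fun_prop
  · refine ContinuousOn.rpow_const ?_ fun _ _ => Or.inr (by norm_num)
    refine continuousOn_finsetProd _ fun i _ z hz => ?_
    have h1 := continuousAt_modNorm_sq_sub (4 * (N : ℚ_[q i])) (hz.2 i trivial).1
    exact (ContinuousAt.comp (f := fun z : ℝ × (∀ i, ℚ_[q i]) => z.2 i) h1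
      (by fun_prop)).continuousWithinAt
  · intro z hz
    have h1 := archNorm_pos hz.1
    have h2 := hpos z hz
    positivity

end Assembly

/-! ### Interchange of the Mellin integral with the semilocal integral. -/

section Fubini

variable {r : ℕ} {q : Fin r → ℕ} [∀ i, Fact (q i).Prime] {sgn : ℤˣ} {N : ℚ} {ι : Fin 2}
  {ε : Fin r → ℤ}

instance semilocalMeasure_sigmaFinite : SigmaFinite (semilocalMeasure q) := by
  unfold semilocalMeasure
  infer_instance

theorem integrable_factors {φbar : ℝ → ℂ} {ψbar : ∀ i, ℚ_[q i] → ℂ} {ξ : ℝ}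
    {η : ∀ i, ℚ_[q i]} {b₀ : ℂ} {b : Fin r → ℂ}
    (h₀ : IntegrableOn (archFactor sgn φbar ξ b₀) (X sgn ι))
    (h : ∀ i, IntegrableOn (padicFactor (q i) N (ψbar i) (η i) (b i)) (Y (q i) N (ε i))
      (padicHaar (q i))) :
    IntegrableOn (fun z => archFactor sgn φbar ξ b₀ z.1 *
      ∏ i, padicFactor (q i) N (ψbar i) (η i) (b i) (z.2 i)) (domain q sgn N ι ε)
      (semilocalMeasure q) := by
  rw [IntegrableOn, restrict_domain]
  exact Integrable.mul_prod h₀ (Integrable.fintype_prod_dep h)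

theorem integral_factors (φbar : ℝ → ℂ) (ψbar : ∀ i, ℚ_[q i] → ℂ) (ξ : ℝ)
    (η : ∀ i, ℚ_[q i]) (b₀ : ℂ) (b : Fin r → ℂ) :
    ∫ z in domain q sgn N ι ε, archFactor sgn φbar ξ b₀ z.1 *
      ∏ i, padicFactor (q i) N (ψbar i) (η i) (b i) (z.2 i) ∂(semilocalMeasure q) =
    (∫ x in X sgn ι, archFactor sgn φbar ξ b₀ x) *
      ∏ i, ∫ y in Y (q i) N (ε i), padicFactor (q i) N (ψbar i) (η i) (b i) y
        ∂(padicHaar (q i)) := by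
  rw [restrict_domain, integral_prod_mul (f := archFactor sgn φbar ξ b₀)
    (g := fun y : ∀ i, ℚ_[q i] => ∏ i, padicFactor (q i) N (ψbar i) (η i) (b i) (y i)),
    integral_fintype_prod_eq_prod]

/-- For `t > 0` the modulus of `t ^ (-(σ + iy))` does not depend on `y`, so the norm of the kernel
is exactly a product of an integrable function of `z` and `‖g y‖`. -/
theorem integrable_mellin_kernel {C : ℝ} (hC : 0 < C) {a₀ : ℂ} {a : Fin r → ℂ} {φbar : ℝ → ℂ}
    (hφ : ContinuousOn φbar (closure (X sgn ι))) {ψbar : ∀ i, ℚ_[q i] → ℂ}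
    (hψ : ∀ i, Continuous (ψbar i)) {ξ : ℝ} {η : ∀ i, ℚ_[q i]} {σ : ℝ} {g : ℝ → ℂ}
    (hg : Continuous g) (hgi : Integrable fun y => ‖g y‖)
    (hi : IntegrableOn (fun z => archFactor sgn φbar ξ ((a₀ + σ) / 2) z.1 *
      ∏ i, padicFactor (q i) N (ψbar i) (η i) ((a i + σ) / 2) (z.2 i)) (domain q sgn N ι ε)
      (semilocalMeasure q)) :
    Integrable (fun zy : (ℝ × (∀ i, ℚ_[q i])) × ℝ =>
      baseFactor q sgn N a₀ a φbar ψbar ξ η zy.1 *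
        (g zy.2 * (phiArg q sgn N C zy.1 : ℂ) ^ (-(σ + zy.2 * Complex.I))))
      (((semilocalMeasure q).restrict (domain q sgn N ι ε)).prod volume) := by
  set D := domain q sgn N ι ε with hD
  have hDm : MeasurableSet D := measurableSet_domain q sgn N ι ε
  have hprod : ((semilocalMeasure q).restrict D).prod (volume : Measure ℝ) =
      ((semilocalMeasure q).prod volume).restrict (D ×ˢ Set.univ) := by
    rw [← Measure.prod_restrict, Measure.restrict_univ]
  have hdom := (((hi.const_mul ((C : ℂ) ^ (-(σ : ℂ)))).norm).mul_prod hgi)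
  refine hdom.mono' ?_ ?_
  · rw [hprod]
    refine ContinuousOn.aestronglyMeasurable ?_ (hDm.prod MeasurableSet.univ)
    refine ContinuousOn.mul ?_ (ContinuousOn.mul ?_ (ContinuousOn.cpow ?_ ?_ ?_))
    · exact (continuousOn_baseFactor hφ hψ a₀ a ξ η).comp continuousOn_fst fun z hz => hz.1
    · exact (hg.comp continuous_snd).continuousOn
    · exact Complex.continuous_ofReal.comp_continuousOn
        (continuousOn_phiArg.comp continuousOn_fst fun z hz => hz.1)
    · fun_prop
    · exact fun z hz => Complex.ofReal_mem_slitPlane.2 (phiArg_pos hC hz.1)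
  · rw [hprod, ae_restrict_iff' (hDm.prod MeasurableSet.univ)]
    refine Eventually.of_forall fun z hz => le_of_eq ?_
    rw [← baseFactor_mul_cpow hC hz.1]
    have hpos := phiArg_pos hC hz.1
    simp only [norm_mul, Complex.norm_cpow_eq_rpow_re_of_pos hpos]
    simp
    ring

theorem mellin_kernel_integral {C : ℝ} (hC : 0 < C) {Φ : ℝ → ℂ} {a₀ : ℂ} {a : Fin r → ℂ}
    {φbar : ℝ → ℂ} (hφ : ContinuousOn φbar (closure (X sgn ι))) {ψbar : ∀ i, ℚ_[q i] → ℂ}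
    (hψ : ∀ i, Continuous (ψbar i)) {ξ : ℝ} {η : ∀ i, ℚ_[q i]} {σ : ℝ} {g : ℝ → ℂ}
    (hg : Continuous g) (hgi : Integrable fun y => ‖g y‖)
    (hΦ : ∀ t : ℝ, 0 < t → Φ t = ∫ y : ℝ, g y * (t : ℂ) ^ (-(σ + y * Complex.I)))
    (hi : IntegrableOn (fun z => archFactor sgn φbar ξ ((a₀ + σ) / 2) z.1 *
      ∏ i, padicFactor (q i) N (ψbar i) (η i) ((a i + σ) / 2) (z.2 i)) (domain q sgn N ι ε)
      (semilocalMeasure q)) :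
    IntegrableOn (integrand q sgn N Φ a₀ a φbar ψbar C ξ η) (domain q sgn N ι ε)
      (semilocalMeasure q) ∧
    ∫ z in domain q sgn N ι ε, integrand q sgn N Φ a₀ a φbar ψbar C ξ η z
      ∂(semilocalMeasure q) =
    ∫ y : ℝ, g y * ((C : ℂ) ^ (-(σ + y * Complex.I)) *
      ((∫ x in X sgn ι, archFactor sgn φbar ξ ((a₀ + (σ + y * Complex.I)) / 2) x) *
        ∏ i, ∫ x in Y (q i) N (ε i),
          padicFactor (q i) N (ψbar i) (η i) ((a i + (σ + y * Complex.I)) / 2) x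
            ∂(padicHaar (q i)))) := by
  have hH := integrable_mellin_kernel (a := a) hC hφ hψ hg hgi hi
  have hDm : MeasurableSet (domain q sgn N ι ε) := measurableSet_domain q sgn N ι ε
  have hinner : ∀ z ∈ domain q sgn N ι ε, integrand q sgn N Φ a₀ a φbar ψbar C ξ η z =
      ∫ y : ℝ, baseFactor q sgn N a₀ a φbar ψbar ξ η z *
        (g y * (phiArg q sgn N C z : ℂ) ^ (-(σ + y * Complex.I))) := fun z hz => by
    rw [integrand_eq, integral_const_mul, hΦ _ (phiArg_pos hC hz)]
  refine ⟨IntegrableOn.congr_fun hH.integral_prod_left (fun z hz => (hinner z hz).symm) hDm, ?_⟩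
  rw [setIntegral_congr_fun hDm hinner, integral_integral_swap hH]
  refine integral_congr_ae (Eventually.of_forall fun y => ?_)
  simp only
  rw [← integral_factors (N := N) (ε := ε), ← integral_const_mul, ← integral_const_mul]
  refine setIntegral_congr_fun hDm fun z hz => ?_
  rw [← baseFactor_mul_cpow hC hz]
  ring

end Fubini

end Semilocal

/-! ### Assembly of the local bounds. -/

open Semilocal in
theorem theoremA1 {r : ℕ} (q : Fin r → ℕ) [∀ i, Fact (q i).Prime] (hq : Function.Injective q)
    (Φ : ℝ → ℂ) (hΦ : Semilocal.ClassS Φ) (hΦM : Semilocal.MellinRapid Φ)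
    (sgn : ℤˣ) (ν : Fin r → ℤ) (ι : Fin 2) (ε : Fin r → ℤ)
    (hε : ∀ i, ε i = 0 ∨ ε i = 1 ∨ ε i = -1)
    (a₀ : ℂ) (a : Fin r → ℂ) (ha₀ : -2 < a₀.re) (ha : ∀ i, -2 < (a i).re)
    (φbar : ℝ → ℂ) (hφ : Semilocal.SmoothUpToBoundary (Semilocal.X sgn ι) φbar)
    (ψbar : ∀ i, ℚ_[q i] → ℂ) (hψ : ∀ i, IsLocallyConstant (ψbar i))
    (hψc : ∀ i, HasCompactSupport (ψbar i))
    (M : ℝ) (hM : 0 < M) :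
    ∃ K : ℝ, ∀ n : ℕ, 0 < n → (∀ i, Nat.Coprime n (q i)) →
      ∀ C : ℝ, 0 < C → ∀ (ξ : ℝ) (η : ∀ i, ℚ_[q i]),
        IntegrableOn
          (Semilocal.integrand q sgn (Semilocal.bigN q sgn ν n) Φ a₀ a φbar ψbar C ξ η)
          (Semilocal.domain q sgn (Semilocal.bigN q sgn ν n) ι ε)
          (Semilocal.semilocalMeasure q) ∧
        ‖∫ z in Semilocal.domain q sgn (Semilocal.bigN q sgn ν n) ι ε,
            Semilocal.integrand q sgn (Semilocal.bigN q sgn ν n) Φ a₀ a φbar ψbar C ξ η z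
            ∂(Semilocal.semilocalMeasure q)‖ ≤
          K * (C ^ 2 * Semilocal.bracket q ξ η) ^ (-M) *
            (1 + |ξ|) ^ (-1 - a₀.re / 2) * ∏ i, (1 + ‖η i‖) ^ (-1 - (a i).re / 2) := by
  -- Since `s` enters the local exponents halved, the abscissa `2 * M` raises each real part by `M`.
  obtain ⟨g, hg, hgi, hinv⟩ := exists_mellin_inversion (σ := 2 * M) hΦ.1.continuousOn hΦM
    (by linarith)
  obtain ⟨K₀, k, hK₀, h₀⟩ := arch_local_bound sgn ι (c := a₀.re / 2 + M) (by linarith) hφ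
  have hloc : ∀ i, ∃ K : ℝ, 0 ≤ K ∧ ∀ n : ℕ, (∀ i, Nat.Coprime n (q i)) → ∀ b : ℂ,
      b.re = (a i).re / 2 + M → ∀ η : ℚ_[q i],
      IntegrableOn (padicFactor (q i) (bigN q sgn ν n) (ψbar i) η b)
        (Y (q i) (bigN q sgn ν n) (ε i)) (padicHaar (q i)) ∧
      ‖∫ y in Y (q i) (bigN q sgn ν n) (ε i),
        padicFactor (q i) (bigN q sgn ν n) (ψbar i) η b y ∂(padicHaar (q i))‖ ≤
        K * (1 + ‖η‖) ^ (-1 - ((a i).re / 2 + M)) := by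
    intro i
    have hκ : 0 < ‖(4 : ℚ_[q i])‖ * (q i : ℝ) ^ (-ν i) :=
      mul_pos (norm_pos_iff.2 (by norm_num))
        (zpow_pos (by exact_mod_cast (Fact.out : (q i).Prime).pos) _)
    obtain ⟨K, hK, h⟩ := padic_local_bound hκ (c := (a i).re / 2 + M) (by linarith [ha i]) (ε i)
      (hψ i) (hψc i)
    exact ⟨K, hK, fun n hn b hb η => h _ (norm_four_mul_bigN q hq sgn ν hn i) b hb η⟩
  choose K hK h using hloc
  set T : ℝ := ∫ y, (1 + |y|) ^ k * ‖g y‖ with hT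
  refine ⟨T * (K₀ * (1 + ‖a₀‖ + 2 * M) ^ k * ∏ i, K i), fun n _ hn C hC ξ η => ?_⟩
  have hre : ∀ (α : ℂ) (y : ℝ), ((α + (((2 * M : ℝ) : ℂ) + y * Complex.I)) / 2).re =
      α.re / 2 + M := fun α y => by
    simp
    ring
  have hint := integrable_factors (N := bigN q sgn ν n) (ι := ι) (ε := ε)
    (b₀ := (a₀ + ((2 * M : ℝ) : ℂ)) / 2) (b := fun i => (a i + ((2 * M : ℝ) : ℂ)) / 2)
    (h₀ _ (by simpa using hre a₀ 0) ξ).1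
    (fun i => (h i n hn _ (by simpa using hre (a i) 0) (η i)).1)
  obtain ⟨hI, hEq⟩ := mellin_kernel_integral hC hφ.1.continuousOn (fun i => (hψ i).continuous)
    hg (by simpa using hgi 0) hinv hint
  refine ⟨hI, ?_⟩
  rw [hEq]
  have hξ : 0 < 1 + |ξ| := by linarith [abs_nonneg ξ]
  have hη : ∀ i, 0 < 1 + ‖η i‖ := fun i => by linarith [norm_nonneg (η i)]
  set W : ℝ := C ^ (-(2 * M)) * ((1 + |ξ|) ^ (-1 - (a₀.re / 2 + M)) *
    ∏ i, (1 + ‖η i‖) ^ (-1 - ((a i).re / 2 + M))) with hW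
  have hW0 : 0 ≤ W := by
    have : 0 ≤ ∏ i, (1 + ‖η i‖) ^ (-1 - ((a i).re / 2 + M)) :=
      Finset.prod_nonneg fun i _ => Real.rpow_nonneg (hη i).le _
    positivity
  -- Each local exponent `-1 - (α + M)` sheds a factor with exponent `-M`; these and `C ^ (-2M)`
  -- recombine into the bracket power.
  have hWeq : W = (C ^ 2 * bracket q ξ η) ^ (-M) * (1 + |ξ|) ^ (-1 - a₀.re / 2) *
      ∏ i, (1 + ‖η i‖) ^ (-1 - (a i).re / 2) := by
    have hb : 0 ≤ ∏ i, (1 + ‖η i‖) := Finset.prod_nonneg fun i _ => (hη i).le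
    have hC2 : (C ^ 2) ^ (-M) = C ^ (-(2 * M)) := by
      rw [← Real.rpow_natCast, ← Real.rpow_mul hC.le]
      congr 1
      push_cast
      ring
    have hsplit : ∀ {t : ℝ} (_ : 0 < t) (α : ℝ), t ^ (-1 - (α + M)) = t ^ (-M) * t ^ (-1 - α) :=
      fun ht α => by
        rw [← Real.rpow_add ht]
        congr 1
        ring
    rw [hW, bracket, Real.mul_rpow (by positivity) (by positivity), Real.mul_rpow hξ.le hb, hC2,
      ← Real.finsetProd_rpow _ _ (fun i _ => (hη i).le), hsplit hξ]
    simp only [hsplit (hη _), Finset.prod_mul_distrib]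
    ring
  have hbound : ∀ y : ℝ, ‖g y * ((C : ℂ) ^ (-(((2 * M : ℝ) : ℂ) + y * Complex.I)) *
      ((∫ x in X sgn ι, archFactor sgn φbar ξ
        ((a₀ + (((2 * M : ℝ) : ℂ) + y * Complex.I)) / 2) x) *
        ∏ i, ∫ x in Y (q i) (bigN q sgn ν n) (ε i), padicFactor (q i) (bigN q sgn ν n) (ψbar i)
          (η i) ((a i + (((2 * M : ℝ) : ℂ) + y * Complex.I)) / 2) x ∂(padicHaar (q i))))‖ ≤
      K₀ * (1 + ‖a₀‖ + 2 * M) ^ k * (∏ i, K i) * W * ((1 + |y|) ^ k * ‖g y‖) := by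
    intro y
    set s : ℂ := ((2 * M : ℝ) : ℂ) + y * Complex.I with hs
    have H₀ := (h₀ ((a₀ + s) / 2) (hre a₀ y) ξ).2
    have Hi : ∏ i, ‖∫ x in Y (q i) (bigN q sgn ν n) (ε i), padicFactor (q i) (bigN q sgn ν n)
        (ψbar i) (η i) ((a i + s) / 2) x ∂(padicHaar (q i))‖ ≤
        (∏ i, K i) * ∏ i, (1 + ‖η i‖) ^ (-1 - ((a i).re / 2 + M)) := by
      rw [← Finset.prod_mul_distrib]
      exact Finset.prod_le_prod (fun i _ => norm_nonneg _) fun i _ =>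
        (h i n hn _ (hre (a i) y) (η i)).2
    have hCn : ‖(C : ℂ) ^ (-s)‖ = C ^ (-(2 * M)) := by
      rw [Complex.norm_cpow_eq_rpow_re_of_pos hC]
      simp [hs]
    -- Only the real place contributes growth in `y`; separating it as a power of `1 + |y|` leaves
    -- the integral `T`.
    have hb : 1 + ‖(a₀ + s) / 2‖ ≤ (1 + ‖a₀‖ + 2 * M) * (1 + |y|) := by
      have h1 : ‖s‖ ≤ 2 * M + |y| := by
        refine (norm_add_le _ _).trans ?_
        rw [norm_mul, Complex.norm_I, Complex.norm_real, Complex.norm_real, Real.norm_eq_abs,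
          Real.norm_eq_abs, abs_of_pos (by linarith : 0 < 2 * M), mul_one]
      have h2 := norm_add_le a₀ s
      rw [norm_div, Complex.norm_ofNat]
      nlinarith [abs_nonneg y, norm_nonneg a₀, mul_nonneg (norm_nonneg a₀) (abs_nonneg y),
        mul_nonneg hM.le (abs_nonneg y)]
    have hPK : 0 ≤ ∏ i, K i := Finset.prod_nonneg fun i _ => hK i
    rw [norm_mul, norm_mul, norm_mul, norm_prod, hCn]
    calc _ ≤ ‖g y‖ * (C ^ (-(2 * M)) * (K₀ * ((1 + ‖a₀‖ + 2 * M) * (1 + |y|)) ^ k *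
          (1 + |ξ|) ^ (-1 - (a₀.re / 2 + M)) *
          ((∏ i, K i) * ∏ i, (1 + ‖η i‖) ^ (-1 - ((a i).re / 2 + M))))) := by
          refine mul_le_mul_of_nonneg_left (mul_le_mul_of_nonneg_left (mul_le_mul
            (H₀.trans ?_) Hi (Finset.prod_nonneg fun i _ => norm_nonneg _) ?_) ?_) (norm_nonneg _)
          · gcongr
          · positivity
          · positivity
      _ = _ := by rw [hW, mul_pow]; ring
  refine (norm_integral_le_of_norm_le ((hgi k).const_mul _)
    (Eventually.of_forall hbound)).trans (le_of_eq ?_)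
  rw [integral_const_mul, ← hT, hWeq]
  ring
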